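/- Setting. Fix a first-order language with infinitely many constants (and any function and predicate symbols), and a set of variables. Formulas are built from atomic formulas (predicate symbols applied to terms; $\top$ and $\bot$ do not count as atomic), $\top$, $\bot$ with $\land,\lor,\supset,\exists,\forall$, and are taken up to renaming of bound variables. A sequent $\Gamma\longrightarrow\Delta$ is a pair of finite multisets of formulas. It is an axiom if $\top\in\Delta$, or if some $A$ that is $\bot$ or atomic lies in both $\Gamma$ and $\Delta$. The inference rules are the following, where "$P_1;P_2\;/\;Q$" means that $Q$ is inferred from $P_1$ and $P_2$. - contr-L: $B,B,\Gamma\longrightarrow\Delta\;/\;B,\Gamma\longrightarrow\Delta$; contr-R: $\Gamma\longrightarrow\Delta,B,B\;/\;\Gamma\longrightarrow\Delta,B$; - $\bot$-R: $\Gamma\longrightarrow\Delta,\bot\;/\;\Gamma\longrightarrow\Delta,D$; - $\land$-L: $B,\Gamma\longrightarrow\Delta\;/\;B\land D,\Gamma\longrightarrow\Delta$ and $D,\Gamma\longrightarrow\Delta\;/\;B\land D,\Gamma\longrightarrow\Delta$; - $\land$-R: $\Gamma\longrightarrow\Delta,B;\ \Gamma\longrightarrow\Delta,D\;/\;\Gamma\longrightarrow\Delta,B\land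 D$; - $\lor$-L: $B,\Gamma\longrightarrow\Delta;\ D,\Gamma\longrightarrow\Delta\;/\;B\lor D,\Gamma\longrightarrow\Delta$; - $\lor$-R: $\Gamma\longrightarrow\Delta,B\;/\;\Gamma\longrightarrow\Delta,B\lor D$ and $\Gamma\longrightarrow\Delta,D\;/\;\Gamma\longrightarrow\Delta,B\lor D$; - $\supset$-L: $\Gamma\longrightarrow\Delta,B;\ D,\Gamma\longrightarrow\Theta\;/\;B\supset D,\Gamma\longrightarrow\Delta,\Theta$; - $\supset$-R: $B,\Gamma\longrightarrow\Delta,D\;/\;\Gamma\longrightarrow\Delta,B\supset D$; - $\forall$-L: $[t/x]B,\Gamma\longrightarrow\Delta\;/\;\forall x\,B,\Gamma\longrightarrow\Delta$ and $\exists$-R: $\Gamma\longrightarrow\Delta,[t/x]B\;/\;\Gamma\longrightarrow\Delta,\exists x\,B$, for any term $t$; - $\exists$-L: $[c/x]B,\Gamma\longrightarrow\Delta\;/\;\exists x\,B,\Gamma\longrightarrow\Delta$ and $\forall$-R: $\Gamma\longrightarrow\Delta,[c/x]B\;/\;\Gamma\longrightarrow\Delta,\forall x\,B$, for any constant $c$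 that does not appear in the lower sequent. A $\mathbf C$-proof is a derivation from axioms by these rules. An $\mathbf I$-proof is a $\mathbf C$-proof in which every sequent has exactly one formula in its succedent. Consider the following four conditions on the set of rules used in a $\mathbf C$-proof: 1. $\forall$-R is not used; 2. neither $\supset$-R nor $\lor$-L is used; 3. neither $\supset$-R nor $\forall$-L is used; 4. none of $\supset$-L, $\lor$-R, $\exists$-R is used. Theorem. (a) Let $\Gamma$ be a finite multiset of formulas and $F$ a formula such that $\Gamma\longrightarrow F$ has a $\mathbf C$-proof satisfying at least one of the conditions 1–4. Then $F\supset\bot,\Gamma\longrightarrow F$ has an $\mathbf I$-proof. (b) Suppose that the language has at least one binary predicate symbol. For each way of violating all four conditions, that is, for each set $S\subseteq\{\forall\text{-R},\supset\text{-R},\lor\text{-L},\forall\text{-L},\supset\text{-L},\lor\text{-R},\exists\text{-R}\}$ for which the conditions 1–4, read with "used" as "belongs to $S$", all fail, there is a sequent $\Gamma\longrightarrow F$ that has a $\mathbf C$-proof using, among these seven rules, exactly those in $S$, while $F\supset\bot,\Gamma\longrightarrow F$ has no $\mathbf I$-proof. -/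

import Mathlib

/-- First-order formulas over the signature `L`, with free variables from `V` and `n` further
variables `0, …, n - 1` that are waiting to be bound. As in Mathlib's `BoundedFormula`, a
quantifier in a formula with `n` such variables binds the variable `n` of its body, so that
formulas are taken up to renaming of bound variables and capture cannot occur.
The formulas that occur in sequents are those with `n = 0`. -/
inductive Fml (L : FirstOrder.Language) (V : Type*) : ℕ → Type _
  | top {n : ℕ} : Fml L V n
  | bot {n : ℕ} : Fml L V n
  | atom {n k : ℕ} (p : L.Relations k) (ts : Fin k → L.Term (V ⊕ Fin n)) : Fml L V n
  | and {n : ℕ} (B D : Fml L V n) : Fml L V n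
  | or {n : ℕ} (B D : Fml L V n) : Fml L V n
  | imp {n : ℕ} (B D : Fml L V n) : Fml L V n
  | ex {n : ℕ} (B : Fml L V (n + 1)) : Fml L V n
  | all {n : ℕ} (B : Fml L V (n + 1)) : Fml L V n

/-- Replace the variable `0` by the term `t`, and rename the variables `i + 1` to `i`. -/
def instTerm {L : FirstOrder.Language} {V : Type*} (t : L.Term V) {n : ℕ}
    (s : L.Term (V ⊕ Fin (n + 1))) : L.Term (V ⊕ Fin n) :=
  s.subst (Sum.elim (fun v => FirstOrder.Language.Term.var (Sum.inl v))
    (Fin.cases (t.relabel Sum.inl) (fun i => FirstOrder.Language.Term.var (Sum.inr i))))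

/-- Auxiliary form of `Fml.inst`, which takes the equation `m = n + 1` as an argument so that the
recursion is structural. -/
def Fml.instAux {L : FirstOrder.Language} {V : Type*} (t : L.Term V) :
    {m : ℕ} → Fml L V m → (n : ℕ) → m = n + 1 → Fml L V n
  | _, .top, _, _ => .top
  | _, .bot, _, _ => .bot
  | _, .atom p ts, _, h => .atom p (fun i => instTerm t (h ▸ ts i))
  | _, .and B D, n, h => .and (B.instAux t n h) (D.instAux t n h)
  | _, .or B D, n, h => .or (B.instAux t n h) (D.instAux t n h)
  | _, .imp B D, n, h => .imp (B.instAux t n h) (D.instAux t n h)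
  | _, .ex B, n, h => .ex (B.instAux t (n + 1) (congrArg (· + 1) h))
  | _, .all B, n, h => .all (B.instAux t (n + 1) (congrArg (· + 1) h))

/-- The result of replacing the outermost bindable variable `0` of a formula by the term `t`.
For `B : Fml L V 1`, the body of a quantified formula, this is `[t/x]B`. -/
def Fml.inst {L : FirstOrder.Language} {V : Type*} (t : L.Term V) {n : ℕ}
    (B : Fml L V (n + 1)) : Fml L V n :=
  B.instAux t n rfl

section InstEquations

variable {L : FirstOrder.Language} {V : Type*} (t : L.Term V) {n : ℕ}

@[simp] theorem Fml.inst_top : (Fml.top : Fml L V (n + 1)).inst t = .top := rfl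

@[simp] theorem Fml.inst_bot : (Fml.bot : Fml L V (n + 1)).inst t = .bot := rfl

@[simp] theorem Fml.inst_atom {k : ℕ} (p : L.Relations k)
    (ts : Fin k → L.Term (V ⊕ Fin (n + 1))) :
    (Fml.atom p ts).inst t = .atom p (fun i => instTerm t (ts i)) := rfl

@[simp] theorem Fml.inst_and (B D : Fml L V (n + 1)) :
    (Fml.and B D).inst t = .and (B.inst t) (D.inst t) := rfl

@[simp] theorem Fml.inst_or (B D : Fml L V (n + 1)) :
    (Fml.or B D).inst t = .or (B.inst t) (D.inst t) := rfl

@[simp] theorem Fml.inst_imp (B D : Fml L V (n + 1)) :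
    (Fml.imp B D).inst t = .imp (B.inst t) (D.inst t) := rfl

@[simp] theorem Fml.inst_ex (B : Fml L V (n + 2)) :
    (Fml.ex B).inst t = .ex (B.inst t) := rfl

@[simp] theorem Fml.inst_all (B : Fml L V (n + 2)) :
    (Fml.all B).inst t = .all (B.inst t) := rfl

end InstEquations

/-- The constant `c` appears in a term. -/
def ConstInTerm {L : FirstOrder.Language} (c : L.Constants) {W : Type*} : L.Term W → Prop
  | .var _ => False
  | @FirstOrder.Language.Term.func _ _ k f ts =>
      (⟨k, f⟩ : Σ k, L.Functions k) = ⟨0, c⟩ ∨ ∃ i, ConstInTerm c (ts i)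

/-- The constant `c` appears in a formula. -/
def ConstIn {L : FirstOrder.Language} {V : Type*} (c : L.Constants) :
    {n : ℕ} → Fml L V n → Prop
  | _, .top => False
  | _, .bot => False
  | _, .atom _ ts => ∃ i, ConstInTerm c (ts i)
  | _, .and B D => ConstIn c B ∨ ConstIn c D
  | _, .or B D => ConstIn c B ∨ ConstIn c D
  | _, .imp B D => ConstIn c B ∨ ConstIn c D
  | _, .ex B => ConstIn c B
  | _, .all B => ConstIn c B

/-- The constant `c` appears in no formula of the sequent `Γ ⟶ Δ`. -/
def FreshFor {L : FirstOrder.Language} {V : Type*} (c : L.Constants)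
    (Γ Δ : Multiset (Fml L V 0)) : Prop :=
  (∀ A ∈ Γ, ¬ ConstIn c A) ∧ (∀ A ∈ Δ, ¬ ConstIn c A)

/-- `⊥` and the atomic formulas. -/
def IsBotOrAtom {L : FirstOrder.Language} {V : Type*} {n : ℕ} : Fml L V n → Prop
  | .bot => True
  | .atom _ _ => True
  | _ => False

/-- `Γ ⟶ Δ` is an axiom. -/
def IsAxiomSequent {L : FirstOrder.Language} {V : Type*} (Γ Δ : Multiset (Fml L V 0)) : Prop :=
  Fml.top ∈ Δ ∨ ∃ A, IsBotOrAtom A ∧ A ∈ Γ ∧ A ∈ Δ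

/-- `CProof Γ Δ` is the type of **C**-proofs of the sequent `Γ ⟶ Δ`. -/
inductive CProof {L : FirstOrder.Language} {V : Type*} :
    Multiset (Fml L V 0) → Multiset (Fml L V 0) → Type _
  | ax {Γ Δ : Multiset (Fml L V 0)} (h : IsAxiomSequent Γ Δ) : CProof Γ Δ
  | contrL {Γ Δ : Multiset (Fml L V 0)} {B : Fml L V 0}
      (d : CProof (B ::ₘ B ::ₘ Γ) Δ) : CProof (B ::ₘ Γ) Δ
  | contrR {Γ Δ : Multiset (Fml L V 0)} {B : Fml L V 0}
      (d : CProof Γ (B ::ₘ B ::ₘ Δ)) : CProof Γ (B ::ₘ Δ)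
  | botR {Γ Δ : Multiset (Fml L V 0)} {D : Fml L V 0}
      (d : CProof Γ (Fml.bot ::ₘ Δ)) : CProof Γ (D ::ₘ Δ)
  | andL₁ {Γ Δ : Multiset (Fml L V 0)} {B D : Fml L V 0}
      (d : CProof (B ::ₘ Γ) Δ) : CProof (Fml.and B D ::ₘ Γ) Δ
  | andL₂ {Γ Δ : Multiset (Fml L V 0)} {B D : Fml L V 0}
      (d : CProof (D ::ₘ Γ) Δ) : CProof (Fml.and B D ::ₘ Γ) Δ
  | orL {Γ Δ : Multiset (Fml L V 0)} {B D : Fml L V 0}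
      (d : CProof (B ::ₘ Γ) Δ) (e : CProof (D ::ₘ Γ) Δ) : CProof (Fml.or B D ::ₘ Γ) Δ
  | andR {Γ Δ : Multiset (Fml L V 0)} {B D : Fml L V 0}
      (d : CProof Γ (B ::ₘ Δ)) (e : CProof Γ (D ::ₘ Δ)) : CProof Γ (Fml.and B D ::ₘ Δ)
  | orR₁ {Γ Δ : Multiset (Fml L V 0)} {B D : Fml L V 0}
      (d : CProof Γ (B ::ₘ Δ)) : CProof Γ (Fml.or B D ::ₘ Δ)
  | orR₂ {Γ Δ : Multiset (Fml L V 0)} {B D : Fml L V 0}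
      (d : CProof Γ (D ::ₘ Δ)) : CProof Γ (Fml.or B D ::ₘ Δ)
  | impL {Γ Δ Θ : Multiset (Fml L V 0)} {B D : Fml L V 0}
      (d : CProof Γ (B ::ₘ Δ)) (e : CProof (D ::ₘ Γ) Θ) : CProof (Fml.imp B D ::ₘ Γ) (Δ + Θ)
  | impR {Γ Δ : Multiset (Fml L V 0)} {B D : Fml L V 0}
      (d : CProof (B ::ₘ Γ) (D ::ₘ Δ)) : CProof Γ (Fml.imp B D ::ₘ Δ)
  | allL {Γ Δ : Multiset (Fml L V 0)} {B : Fml L V 1} (t : L.Term V)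
      (d : CProof (B.inst t ::ₘ Γ) Δ) : CProof (Fml.all B ::ₘ Γ) Δ
  | exR {Γ Δ : Multiset (Fml L V 0)} {B : Fml L V 1} (t : L.Term V)
      (d : CProof Γ (B.inst t ::ₘ Δ)) : CProof Γ (Fml.ex B ::ₘ Δ)
  | exL {Γ Δ : Multiset (Fml L V 0)} {B : Fml L V 1} (c : L.Constants)
      (hc : FreshFor c (Fml.ex B ::ₘ Γ) Δ)
      (d : CProof (B.inst c.term ::ₘ Γ) Δ) : CProof (Fml.ex B ::ₘ Γ) Δ
  | allR {Γ Δ : Multiset (Fml L V 0)} {B : Fml L V 1} (c : L.Constants)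
      (hc : FreshFor c Γ (Fml.all B ::ₘ Δ))
      (d : CProof Γ (B.inst c.term ::ₘ Δ)) : CProof Γ (Fml.all B ::ₘ Δ)

/-- The names of the inference rules. -/
inductive Rule
  | contrL | contrR | botR | andL | orL | andR | orR | impL | impR | allL | exR | exL | allR

/-- The set of (names of) inference rules used in a **C**-proof. -/
def CProof.rules {L : FirstOrder.Language} {V : Type*} {Γ Δ : Multiset (Fml L V 0)} :
    CProof Γ Δ → Set Rule
  | .ax _ => ∅
  | .contrL d => {Rule.contrL} ∪ d.rules
  | .contrR d => {Rule.contrR} ∪ d.rules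
  | .botR d => {Rule.botR} ∪ d.rules
  | .andL₁ d => {Rule.andL} ∪ d.rules
  | .andL₂ d => {Rule.andL} ∪ d.rules
  | .orL d e => {Rule.orL} ∪ (d.rules ∪ e.rules)
  | .andR d e => {Rule.andR} ∪ (d.rules ∪ e.rules)
  | .orR₁ d => {Rule.orR} ∪ d.rules
  | .orR₂ d => {Rule.orR} ∪ d.rules
  | .impL d e => {Rule.impL} ∪ (d.rules ∪ e.rules)
  | .impR d => {Rule.impR} ∪ d.rules
  | .allL _ d => {Rule.allL} ∪ d.rules
  | .exR _ d => {Rule.exR} ∪ d.rules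
  | .exL _ _ d => {Rule.exL} ∪ d.rules
  | .allR _ _ d => {Rule.allR} ∪ d.rules

/-- A **C**-proof is an **I**-proof if every sequent in it, including the last one, has exactly
one formula in its succedent. -/
def CProof.IsIProof {L : FirstOrder.Language} {V : Type*} {Γ Δ : Multiset (Fml L V 0)}
    (π : CProof Γ Δ) : Prop :=
  Δ.card = 1 ∧
    match π with
    | .ax _ => True
    | .contrL d => d.IsIProof
    | .contrR d => d.IsIProof
    | .botR d => d.IsIProof
    | .andL₁ d => d.IsIProof
    | .andL₂ d => d.IsIProof
    | .orL d e => d.IsIProof ∧ e.IsIProof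
    | .andR d e => d.IsIProof ∧ e.IsIProof
    | .orR₁ d => d.IsIProof
    | .orR₂ d => d.IsIProof
    | .impL d e => d.IsIProof ∧ e.IsIProof
    | .impR d => d.IsIProof
    | .allL _ d => d.IsIProof
    | .exR _ d => d.IsIProof
    | .exL _ _ d => d.IsIProof
    | .allR _ _ d => d.IsIProof

/-- `Γ ⟶ F` has an **I**-proof. -/
def IProvable {L : FirstOrder.Language} {V : Type*} (Γ : Multiset (Fml L V 0))
    (F : Fml L V 0) : Prop :=
  ∃ π : CProof Γ {F}, π.IsIProof

/-- The four conditions on a set `S` of used rules, at least one of which is to hold. -/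
def MeetsSomeCondition (S : Set Rule) : Prop :=
  Rule.allR ∉ S ∨
  (Rule.impR ∉ S ∧ Rule.orL ∉ S) ∨
  (Rule.impR ∉ S ∧ Rule.allL ∉ S) ∨
  (Rule.impL ∉ S ∧ Rule.orR ∉ S ∧ Rule.exR ∉ S)

/-- The seven rules that the four conditions mention. -/
def restrictedRules : Set Rule :=
  {Rule.allR, Rule.impR, Rule.orL, Rule.allL, Rule.impL, Rule.orR, Rule.exR}

/-! Both halves are semantic: formulas take values in a frame (a complete Heyting algebra), and
constants are valued by a separate map `κ`, so that an eigenconstant can be revalued at will.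

For (a), a **C**-proof of `Γ ⟶ F` is evaluated in an arbitrary frame to show that every `x` below `F
⊃ ⊥` and `Γ` is below `F`. Each condition has its own induction invariant. 1. Without `∀`-R, `Γ`
together with the negations of the succedent formulas entails `⊥` (`le_bot_of_allR_notMem`). This is
a Glivenko argument, and `F ⊃ ⊥` supplies the negation of `F`. 2. Without `⊃`-R and `∨`-L, a single
formula of the succedent, fixed in advance, follows (`exists_le_value`). 3. Without `⊃`-R and `∀`-L,
`Γ` is covered by cases in each of which one succedent formula holds uniformly in the constants
outside `Γ` (`le_of_forall_agreeOn`). 4. Without `⊃`-L, `∨`-R and `∃`-R, formulas of the succedent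
are only decomposed along paths through `∧`, `⊃` and `∀`. The antecedents met on the way move to the
left, and the proof follows the chosen paths (`le_of_forall_path`). Under conditions 2–4 the
antecedent `Γ` alone already entails `F`.

An **I**-proof is then recovered by an algebraic completeness argument that needs no cut
elimination. In the frame of sets of antecedents closed under a derivability nucleus, the value of
`A` contains every antecedent that has `A` as a member and consists of antecedents that derive `A`
(`Ctx.tmValue_spec`).

For (b), the sets that violate all conditions are those containing `∀`-R, one of `⊃`-R or the pair
`∨`-L, `∀`-L, and one of `⊃`-L, `∨`-R, `∃`-R. Six basic sequents, all refuted in one model over the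
open sets of `ℝ`, cover them (`exists_base`). The model exploits that an infimum of dense open sets
may be empty, so that `∀` does not commute with double negation. The remaining rules of `S` are
added by conjoining `F` with valid formulas (`exists_extend_cProvableUsing`). -/

/-- The part of an algebra-valued interpretation that does not depend on the constants: a function
on `D` for every function symbol of positive arity, an `H`-valued relation for every predicate
symbol, and an element of `D` for every free variable. -/
structure Interp (L : FirstOrder.Language) (V : Type*) (H D : Type*) where
  fn : ∀ {k : ℕ}, L.Functions (k + 1) → (Fin (k + 1) → D) → D
  rel : ∀ {k : ℕ}, L.Relations k → (Fin k → D) → H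
  vr : V → D

/-! ### Frame-valued semantics and substitution -/

namespace Interp

open FirstOrder.Language

variable {L : FirstOrder.Language} {V H D : Type*}

/-- The interpretation of a function symbol, where the constants are interpreted by `κ`. -/
def app (M : Interp L V H D) (κ : L.Constants → D) :
    {k : ℕ} → L.Functions k → (Fin k → D) → D
  | 0, f, _ => κ f
  | _ + 1, f, a => M.fn f a

/-- The value of a term. -/
def tval (M : Interp L V H D) (κ : L.Constants → D) {W : Type*} (e : W → D) : L.Term W → D
  | .var v => e v
  | .func f ts => M.app κ f (fun i => M.tval κ e (ts i))

theorem tval_subst (M : Interp L V H D) (κ : L.Constants → D) {W W' : Type*} (e : W' → D)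
    (σ : W → L.Term W') (s : L.Term W) :
    M.tval κ e (s.subst σ) = M.tval κ (fun w => M.tval κ e (σ w)) s := by
  induction s with
  | var v => rfl
  | func f ts ih => simp [Term.subst, tval, ih]

theorem tval_relabel (M : Interp L V H D) (κ : L.Constants → D) {W W' : Type*} (e : W' → D)
    (g : W → W') (s : L.Term W) : M.tval κ e (s.relabel g) = M.tval κ (e ∘ g) s := by
  induction s with
  | var v => rfl
  | func f ts ih => simp [Term.relabel, tval, ih]

theorem tval_congr (M : Interp L V H D) {κ κ' : L.Constants → D} {W : Type*} (e : W → D)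
    (s : L.Term W) (h : ∀ c, ConstInTerm c s → κ c = κ' c) :
    M.tval κ e s = M.tval κ' e s := by
  induction s with
  | var v => rfl
  | @func k f ts ih =>
    have h1 : ∀ i, M.tval κ e (ts i) = M.tval κ' e (ts i) := fun i =>
      ih i fun c hc => h c (Or.inr ⟨i, hc⟩)
    cases k with
    | zero => exact h f (Or.inl rfl)
    | succ k => simp [tval, app, h1]

@[simp] theorem tval_const (M : Interp L V H D) (κ : L.Constants → D) {W : Type*} (e : W → D)
    (c : L.Constants) : M.tval κ e c.term = κ c := rfl

theorem tval_instTerm (M : Interp L V H D) (κ : L.Constants → D) (t : L.Term V) {n : ℕ}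
    (s : L.Term (V ⊕ Fin (n + 1))) (xs : Fin n → D) :
    M.tval κ (Sum.elim M.vr xs) (instTerm t s) =
      M.tval κ (Sum.elim M.vr (Fin.cons (M.tval κ M.vr t) xs : Fin (n + 1) → D)) s := by
  rw [instTerm, tval_subst]
  congr 1
  funext w
  rcases w with v | i
  · rfl
  · refine Fin.cases ?_ (fun i => ?_) i
    · simp [tval_relabel]
    · simp [tval]

variable [Order.Frame H]

/-- The value of a formula in the frame `H`. -/
def val (M : Interp L V H D) (κ : L.Constants → D) : {n : ℕ} → Fml L V n → (Fin n → D) → H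
  | _, .top, _ => ⊤
  | _, .bot, _ => ⊥
  | _, .atom p ts, xs => M.rel p fun i => M.tval κ (Sum.elim M.vr xs) (ts i)
  | _, .and B C, xs => M.val κ B xs ⊓ M.val κ C xs
  | _, .or B C, xs => M.val κ B xs ⊔ M.val κ C xs
  | _, .imp B C, xs => M.val κ B xs ⇨ M.val κ C xs
  | n, .ex B, xs => ⨆ d : D, M.val κ B (Fin.snoc xs d : Fin (n + 1) → D)
  | n, .all B, xs => ⨅ d : D, M.val κ B (Fin.snoc xs d : Fin (n + 1) → D)

theorem val_congr (M : Interp L V H D) {κ κ' : L.Constants → D} {n : ℕ} (A : Fml L V n)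
    (xs : Fin n → D) (h : ∀ c, ConstIn c A → κ c = κ' c) : M.val κ A xs = M.val κ' A xs := by
  induction A with
  | top => rfl
  | bot => rfl
  | atom p ts =>
    simp only [val]
    congr 1
    funext i
    exact M.tval_congr _ _ fun c hc => h c ⟨i, hc⟩
  | and B C ihB ihC | or B C ihB ihC | imp B C ihB ihC =>
    simp only [val, ihB xs fun c hc => h c (Or.inl hc), ihC xs fun c hc => h c (Or.inr hc)]
  | ex B ih | all B ih => simp only [val, fun ys => ih ys h]

theorem val_instAux (M : Interp L V H D) (κ : L.Constants → D) (t : L.Term V) {m : ℕ}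
    (B : Fml L V m) : ∀ (n : ℕ) (h : m = n + 1) (xs : Fin n → D),
      M.val κ (B.instAux t n h) xs =
        M.val κ B (fun i => (Fin.cons (M.tval κ M.vr t) xs : Fin (n + 1) → D) (Fin.cast h i)) := by
  induction B with
  | top => intros; rfl
  | bot => intros; rfl
  | atom p ts =>
    rintro n rfl xs
    simp only [Fml.instAux, val, tval_instTerm]
    rfl
  | and B C ihB ihC | or B C ihB ihC | imp B C ihB ihC =>
    intro n h xs
    simp only [Fml.instAux, val, ihB, ihC]
  | ex B ih | all B ih =>
    rintro n rfl xs
    simp only [Fml.instAux, val, ih]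
    -- Instantiation prepends a value to the assignment and a quantifier appends one; the two
    -- operations commute.
    simp only [Fin.cast_refl, id, ← Fin.cons_snoc_eq_snoc_cons]

theorem val_inst (M : Interp L V H D) (κ : L.Constants → D) (t : L.Term V) {n : ℕ}
    (B : Fml L V (n + 1)) (xs : Fin n → D) :
    M.val κ (B.inst t) xs = M.val κ B (Fin.cons (M.tval κ M.vr t) xs) :=
  M.val_instAux κ t B n rfl xs

/-- The value of a formula that may occur in a sequent. -/
abbrev value (M : Interp L V H D) (κ : L.Constants → D) (A : Fml L V 0) : H := M.val κ A ![]

/-- The value of the body of a quantified formula at an element of the domain. -/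
abbrev bodyValue (M : Interp L V H D) (κ : L.Constants → D) (B : Fml L V 1) (d : D) : H :=
  M.val κ B ![d]

theorem snoc_empty {α : Type*} (xs : Fin 0 → α) (d : α) : (Fin.snoc xs d : Fin 1 → α) = ![d] := by
  funext i
  fin_cases i
  rfl

theorem cons_empty {α : Type*} (xs : Fin 0 → α) (d : α) : (Fin.cons d xs : Fin 1 → α) = ![d] := by
  funext i
  fin_cases i
  rfl

variable (M : Interp L V H D) (κ : L.Constants → D)

theorem value_inst (t : L.Term V) (B : Fml L V 1) :
    M.value κ (B.inst t) = M.bodyValue κ B (M.tval κ M.vr t) := by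
  rw [value, val_inst, cons_empty]

theorem value_ex (B : Fml L V 1) : M.value κ (.ex B) = ⨆ d, M.bodyValue κ B d := by
  simp only [value, val, snoc_empty]

theorem value_all (B : Fml L V 1) : M.value κ (.all B) = ⨅ d, M.bodyValue κ B d := by
  simp only [value, val, snoc_empty]

open Classical in
/-- Reinterpret the constant `c` as `d`. -/
noncomputable def upd (κ : L.Constants → D) (c : L.Constants) (d : D) : L.Constants → D :=
  Function.update κ c d

theorem upd_same (c : L.Constants) (d : D) : upd κ c d c = d := by simp [upd]

theorem upd_of_ne {c c' : L.Constants} (d : D) (h : c' ≠ c) : upd κ c d c' = κ c' := by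
  simp [upd, h]

theorem value_upd {c : L.Constants} (d : D) {A : Fml L V 0} (h : ¬ ConstIn c A) :
    M.value (upd κ c d) A = M.value κ A :=
  M.val_congr _ _ fun _ hc' => upd_of_ne κ d fun e => h (e ▸ hc')

theorem value_inst_upd {c : L.Constants} (d : D) {B : Fml L V 1} (h : ¬ ConstIn c B) :
    M.value (upd κ c d) (B.inst c.term) = M.bodyValue κ B d := by
  rw [value_inst, tval_const, upd_same]
  exact M.val_congr _ _ fun _ hc' => upd_of_ne κ d fun e => h (e ▸ hc')

end Interp

/-! ### Soundness of **I**-proofs, and the invariants for conditions 1 and 2 -/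

namespace Interp

open FirstOrder.Language

variable {L : FirstOrder.Language} {V H D : Type*} [Order.Frame H] (M : Interp L V H D)

/-- Revaluing a constant that is absent from the quantified formula runs its instance through all
values of the body. This is the soundness of `∀`-R, with the eigenvariable condition expressed by
`upd`. -/
theorem bodyValue_le_of_forall_upd {κ : L.Constants → D} {c : L.Constants} {B : Fml L V 1} {x : H}
    (hc : ¬ ConstIn c (Fml.all B)) (h : ∀ d, x ≤ M.value (upd κ c d) (B.inst c.term)) :
    x ≤ M.value κ (.all B) := by
  rw [value_all]
  exact le_iInf fun d => (h d).trans (M.value_inst_upd κ d hc).le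

theorem le_of_le_iSup_of_inf_le {ι : Type*} {x y : H} {f : ι → H} (h : x ≤ ⨆ i, f i)
    (h' : ∀ i, x ⊓ f i ≤ y) : x ≤ y := by
  rw [← inf_eq_left.2 h, inf_iSup_eq]
  exact iSup_le h'

theorem le_of_le_sup_of_inf_le {x y a b : H} (h : x ≤ a ⊔ b) (h1 : x ⊓ a ≤ y) (h2 : x ⊓ b ≤ y) :
    x ≤ y := by
  rw [← inf_eq_left.2 h, inf_sup_left]
  exact sup_le h1 h2

/-- `x` lies below the value of every formula of `Γ`. -/
def Below (κ : L.Constants → D) (x : H) (Γ : Multiset (Fml L V 0)) : Prop :=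
  ∀ A ∈ Γ, x ≤ M.value κ A

variable {M} {κ : L.Constants → D} {x y : H} {Γ Δ : Multiset (Fml L V 0)} {A B : Fml L V 0}

theorem below_cons : M.Below κ x (A ::ₘ Γ) ↔ x ≤ M.value κ A ∧ M.Below κ x Γ := by
  simp [Below]

theorem Below.mono (h : M.Below κ x Γ) (hy : y ≤ x) : M.Below κ y Γ :=
  fun A hA => hy.trans (h A hA)

theorem Below.upd (h : M.Below κ x Γ) {c : L.Constants} (hc : ∀ A ∈ Γ, ¬ ConstIn c A) (d : D) :
    M.Below (Interp.upd κ c d) x Γ :=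
  fun A hA => (h A hA).trans (M.value_upd κ d (hc A hA)).ge

theorem Below.cons_inf (h : M.Below κ x Γ) (hy : y ≤ M.value κ A) :
    M.Below κ (x ⊓ y) (A ::ₘ Γ) :=
  below_cons.2 ⟨inf_le_right.trans hy, h.mono inf_le_left⟩

variable (M)

theorem value_and (C E : Fml L V 0) : M.value κ (.and C E) = M.value κ C ⊓ M.value κ E := rfl

theorem value_or (C E : Fml L V 0) : M.value κ (.or C E) = M.value κ C ⊔ M.value κ E := rfl

theorem value_imp (C E : Fml L V 0) : M.value κ (.imp C E) = M.value κ C ⇨ M.value κ E := rfl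

theorem below_of_cons_inst_upd {B : Fml L V 1} {c : L.Constants}
    (hc : FreshFor c (Fml.ex B ::ₘ Γ) Δ) (h : M.Below κ x Γ) (d : D) :
    M.Below (Interp.upd κ c d) (x ⊓ M.bodyValue κ B d) (B.inst c.term ::ₘ Γ) := by
  refine (h.upd (fun A hA => hc.1 A (Multiset.mem_cons_of_mem hA)) d).cons_inf ?_
  rw [M.value_inst_upd κ d (B := B) (hc.1 _ (Multiset.mem_cons_self _ _))]

/-- Soundness of **I**-proofs. -/
theorem le_value_of_isIProof (π : CProof Γ Δ) (hπ : π.IsIProof) (h : M.Below κ x Γ) :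
    M.Below κ x Δ := by
  induction π generalizing κ x with
  | @ax Γ Δ hax =>
    obtain ⟨F, rfl⟩ := Multiset.card_eq_one.1 hπ.1
    rcases hax with hT | ⟨A, -, hA, hA'⟩
    · rw [Multiset.mem_singleton] at hT
      subst hT
      simp [Below, value, val]
    · rw [Multiset.mem_singleton] at hA'
      subst hA'
      simpa [Below] using h A hA
  | contrL d ih => exact ih hπ.2 (by simpa [below_cons] using h)
  | contrR d ih => simpa [below_cons] using ih hπ.2 h
  | botR d ih =>
    have := below_cons.1 (ih hπ.2 h)
    exact below_cons.2 ⟨this.1.trans bot_le, this.2⟩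
  | andL₁ d ih =>
    rw [below_cons, value_and, le_inf_iff] at h
    exact ih hπ.2 (below_cons.2 ⟨h.1.1, h.2⟩)
  | andL₂ d ih =>
    rw [below_cons, value_and, le_inf_iff] at h
    exact ih hπ.2 (below_cons.2 ⟨h.1.2, h.2⟩)
  | orL d e ihd ihe =>
    rw [below_cons, value_or] at h
    intro A hA
    exact le_of_le_sup_of_inf_le h.1 (ihd hπ.2.1 (h.2.cons_inf le_rfl) A hA)
      (ihe hπ.2.2 (h.2.cons_inf le_rfl) A hA)
  | andR d e ihd ihe =>
    have h1 := below_cons.1 (ihd hπ.2.1 h)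
    have h2 := below_cons.1 (ihe hπ.2.2 h)
    exact below_cons.2 ⟨le_inf h1.1 h2.1, h1.2⟩
  | orR₁ d ih =>
    have h1 := below_cons.1 (ih hπ.2 h)
    exact below_cons.2 ⟨h1.1.trans le_sup_left, h1.2⟩
  | orR₂ d ih =>
    have h1 := below_cons.1 (ih hπ.2 h)
    exact below_cons.2 ⟨h1.1.trans le_sup_right, h1.2⟩
  | impL d e ihd ihe =>
    rw [below_cons, value_imp] at h
    have h1 := below_cons.1 (ihd hπ.2.1 h.2)
    have h2 := ihe hπ.2.2 (below_cons.2 ⟨(le_inf h.1 h1.1).trans himp_inf_le, h.2⟩)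
    intro A hA
    rcases Multiset.mem_add.1 hA with hA | hA
    exacts [h1.2 A hA, h2 A hA]
  | @impR Γ Δ B C d ih =>
    -- A one-formula succedent leaves no side formulas. Any side formula would be bounded only on `x
    -- ⊓ M.value κ B`, which is where `⊃`-R fails for multiple succedents.
    have h0 : Δ = 0 := by simpa using hπ.1
    subst h0
    have h1 := below_cons.1 (ih hπ.2 (h.cons_inf le_rfl))
    exact below_cons.2 ⟨le_himp_iff.2 h1.1, by simp [Below]⟩
  | allL t d ih =>
    rw [below_cons, value_all] at h
    exact ih hπ.2 (below_cons.2 ⟨(h.1.trans (iInf_le _ _)).trans (M.value_inst _ _ _).ge, h.2⟩)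
  | exR t d ih =>
    have h1 := below_cons.1 (ih hπ.2 h)
    refine below_cons.2 ⟨?_, h1.2⟩
    rw [value_inst] at h1
    rw [value_ex]
    exact h1.1.trans (le_iSup (M.bodyValue κ _) _)
  | exL c hc d ih =>
    rw [below_cons, value_ex] at h
    intro A hA
    refine le_of_le_iSup_of_inf_le h.1 fun e => ?_
    exact (ih hπ.2 (M.below_of_cons_inst_upd hc h.2 e) A hA).trans
      (M.value_upd κ e (hc.2 A hA)).le
  | @allR Γ Δ B c hc d ih =>
    have h0 : Δ = 0 := by simpa using hπ.1
    subst h0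
    refine below_cons.2 ⟨?_, by simp [Below]⟩
    exact M.bodyValue_le_of_forall_upd (hc.2 _ (Multiset.mem_cons_self _ _))
      fun e => (below_cons.1 (ih hπ.2 (h.upd hc.1 e))).1

/-- Glivenko's argument: a refutation of the succedent passes from the conclusion of each rule to
its premises, because double negation commutes with `∧` and `⊃`. It does not commute with infinite
meets, hence the exclusion of `∀`-R. -/
theorem le_bot_of_allR_notMem (π : CProof Γ Δ) (hπ : Rule.allR ∉ π.rules) (h : M.Below κ x Γ)
    (h' : ∀ A ∈ Δ, x ⊓ M.value κ A ≤ ⊥) : x ≤ ⊥ := by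
  induction π generalizing κ x with
  | ax hax =>
    rcases hax with hT | ⟨A, -, hA, hA'⟩
    · simpa [value, val] using h' _ hT
    · exact (le_inf le_rfl (h A hA)).trans (h' A hA')
  | contrL d ih => exact ih (by simpa [CProof.rules] using hπ) (by simpa [below_cons] using h) h'
  | contrR d ih => exact ih (by simpa [CProof.rules] using hπ) h (by simpa using h')
  | botR d ih =>
    simp only [Multiset.forall_mem_cons] at h' ih
    exact ih (by simpa [CProof.rules] using hπ) h ⟨inf_le_right, h'.2⟩
  | andL₁ d ih =>
    rw [below_cons, value_and, le_inf_iff] at h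
    exact ih (by simpa [CProof.rules] using hπ) (below_cons.2 ⟨h.1.1, h.2⟩) h'
  | andL₂ d ih =>
    rw [below_cons, value_and, le_inf_iff] at h
    exact ih (by simpa [CProof.rules] using hπ) (below_cons.2 ⟨h.1.2, h.2⟩) h'
  | orL d e ihd ihe =>
    rw [below_cons, value_or] at h
    simp [CProof.rules] at hπ
    exact le_of_le_sup_of_inf_le h.1
      (ihd hπ.1 (h.2.cons_inf le_rfl) fun A hA => (by gcongr; exact inf_le_left : _ ≤ _).trans (h' A hA))
      (ihe hπ.2 (h.2.cons_inf le_rfl) fun A hA => (by gcongr; exact inf_le_left : _ ≤ _).trans (h' A hA))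
  | andR d e ihd ihe =>
    simp only [Multiset.forall_mem_cons, value_and] at h' ihd ihe
    simp [CProof.rules] at hπ
    -- Since `x` is incompatible with the conjunction, `x` met with the second conjunct is
    -- incompatible with the first. The left premise then makes `x` incompatible with the second
    -- conjunct, as the right premise requires.
    refine ihe hπ.2 h ⟨?_, h'.2⟩
    refine ihd hπ.1 (h.mono inf_le_left) ⟨?_, fun A hA =>
      (by gcongr; exact inf_le_left : _ ≤ _).trans (h'.2 A hA)⟩
    rw [inf_assoc, inf_comm (M.value _ _)]
    exact h'.1
  | orR₁ d ih =>
    simp only [Multiset.forall_mem_cons, value_or] at h' ih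
    exact ih (by simpa [CProof.rules] using hπ) h
      ⟨(by gcongr; exact le_sup_left : _ ≤ _).trans h'.1, h'.2⟩
  | orR₂ d ih =>
    simp only [Multiset.forall_mem_cons, value_or] at h' ih
    exact ih (by simpa [CProof.rules] using hπ) h
      ⟨(by gcongr; exact le_sup_right : _ ≤ _).trans h'.1, h'.2⟩
  | @impL Γ Δ Θ B C d e ihd ihe =>
    simp only [Multiset.forall_mem_cons] at ihd
    simp only [Multiset.mem_add] at h'
    simp [CProof.rules] at hπ
    rw [below_cons, value_imp] at h
    refine ihd hπ.1 h.2 ⟨?_, fun A hA => h' A (Or.inl hA)⟩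
    refine ihe hπ.2 (below_cons.2 ⟨le_himp_iff.1 h.1, h.2.mono inf_le_left⟩) fun A hA =>
      (by gcongr; exact inf_le_left : _ ≤ _).trans (h' A (Or.inr hA))
  | @impR Γ Δ B C d ih =>
    simp only [Multiset.forall_mem_cons, value_imp] at h' ih
    -- Since `C` entails `B ⊃ C`, the premise refutes `B` under `x`. Then `B ⊃ C` holds vacuously
    -- under `x`, which contradicts its refutation.
    have hB : x ⊓ M.value κ B ≤ ⊥ := by
      refine ih (by simpa [CProof.rules] using hπ) (h.cons_inf le_rfl) ⟨?_, fun A hA =>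
        (by gcongr; exact inf_le_left : _ ≤ _).trans (h'.2 A hA)⟩
      refine le_trans ?_ h'.1
      exact inf_le_inf inf_le_left le_himp
    refine (le_inf le_rfl ?_).trans h'.1
    exact le_himp_iff.2 (hB.trans bot_le)
  | allL t d ih =>
    rw [below_cons, value_all] at h
    exact ih (by simpa [CProof.rules] using hπ)
      (below_cons.2 ⟨(h.1.trans (iInf_le _ _)).trans (M.value_inst _ _ _).ge, h.2⟩) h'
  | exR t d ih =>
    simp only [Multiset.forall_mem_cons, value_ex] at h' ih
    refine ih (by simpa [CProof.rules] using hπ) h ⟨le_trans ?_ h'.1, h'.2⟩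
    gcongr
    rw [value_inst]
    exact le_iSup (M.bodyValue κ _) _
  | exL c hc d ih =>
    rw [below_cons, value_ex] at h
    refine le_of_le_iSup_of_inf_le h.1 fun e => ?_
    refine ih (by simpa [CProof.rules] using hπ) (M.below_of_cons_inst_upd hc h.2 e) fun A hA => ?_
    rw [M.value_upd κ e (hc.2 A hA)]
    exact (by gcongr; exact inf_le_left : _ ≤ _).trans (h' A hA)
  | allR c hc d ih => simp [CProof.rules] at hπ

/-- If neither `⊃`-R nor `∨`-L is used, then one formula of the succedent follows. -/
theorem exists_le_value (π : CProof Γ Δ) (h1 : Rule.impR ∉ π.rules) (h2 : Rule.orL ∉ π.rules) :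
    ∃ A ∈ Δ, ∀ (κ : L.Constants → D) (x : H), M.Below κ x Γ → x ≤ M.value κ A := by
  induction π with
  | ax hax =>
    rcases hax with hT | ⟨A, -, hA, hA'⟩
    · exact ⟨_, hT, by simp [value, val]⟩
    · exact ⟨A, hA', fun κ x h => h A hA⟩
  | contrL d ih =>
    simp [CProof.rules] at h1 h2
    simpa [below_cons] using ih h1 h2
  | contrR d ih =>
    simp [CProof.rules] at h1 h2
    simpa using ih h1 h2
  | botR d ih =>
    simp [CProof.rules] at h1 h2
    obtain ⟨A, hA, h⟩ := ih h1 h2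
    rcases Multiset.mem_cons.1 hA with rfl | hA
    · exact ⟨_, Multiset.mem_cons_self _ _, fun κ x hx => (h κ x hx).trans bot_le⟩
    · exact ⟨A, Multiset.mem_cons_of_mem hA, h⟩
  | andL₁ d ih =>
    simp [CProof.rules] at h1 h2
    obtain ⟨A, hA, h⟩ := ih h1 h2
    refine ⟨A, hA, fun κ x hx => h κ x ?_⟩
    rw [below_cons, value_and, le_inf_iff] at hx
    exact below_cons.2 ⟨hx.1.1, hx.2⟩
  | andL₂ d ih =>
    simp [CProof.rules] at h1 h2
    obtain ⟨A, hA, h⟩ := ih h1 h2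
    refine ⟨A, hA, fun κ x hx => h κ x ?_⟩
    rw [below_cons, value_and, le_inf_iff] at hx
    exact below_cons.2 ⟨hx.1.2, hx.2⟩
  | orL d e ihd ihe => simp [CProof.rules] at h2
  | andR d e ihd ihe =>
    simp [CProof.rules] at h1 h2
    obtain ⟨A, hA, h⟩ := ihd h1.1 h2.1
    obtain ⟨A', hA', h'⟩ := ihe h1.2 h2.2
    rcases Multiset.mem_cons.1 hA with rfl | hA
    · rcases Multiset.mem_cons.1 hA' with rfl | hA'
      · exact ⟨_, Multiset.mem_cons_self _ _, fun κ x hx => le_inf (h κ x hx) (h' κ x hx)⟩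
      · exact ⟨A', Multiset.mem_cons_of_mem hA', h'⟩
    · exact ⟨A, Multiset.mem_cons_of_mem hA, h⟩
  | orR₁ d ih =>
    simp [CProof.rules] at h1 h2
    obtain ⟨A, hA, h⟩ := ih h1 h2
    rcases Multiset.mem_cons.1 hA with rfl | hA
    · exact ⟨_, Multiset.mem_cons_self _ _, fun κ x hx => (h κ x hx).trans le_sup_left⟩
    · exact ⟨A, Multiset.mem_cons_of_mem hA, h⟩
  | orR₂ d ih =>
    simp [CProof.rules] at h1 h2
    obtain ⟨A, hA, h⟩ := ih h1 h2
    rcases Multiset.mem_cons.1 hA with rfl | hA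
    · exact ⟨_, Multiset.mem_cons_self _ _, fun κ x hx => (h κ x hx).trans le_sup_right⟩
    · exact ⟨A, Multiset.mem_cons_of_mem hA, h⟩
  | impL d e ihd ihe =>
    simp [CProof.rules] at h1 h2
    obtain ⟨A, hA, h⟩ := ihd h1.1 h2.1
    obtain ⟨A', hA', h'⟩ := ihe h1.2 h2.2
    rcases Multiset.mem_cons.1 hA with rfl | hA
    · refine ⟨A', Multiset.mem_add.2 (Or.inr hA'), fun κ x hx => ?_⟩
      rw [below_cons, value_imp] at hx
      exact h' κ x (below_cons.2 ⟨(le_inf hx.1 (h κ x hx.2)).trans himp_inf_le, hx.2⟩)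
    · exact ⟨A, Multiset.mem_add.2 (Or.inl hA), fun κ x hx => h κ x (below_cons.1 hx).2⟩
  | impR d ih => simp [CProof.rules] at h1
  | allL t d ih =>
    simp [CProof.rules] at h1 h2
    obtain ⟨A, hA, h⟩ := ih h1 h2
    refine ⟨A, hA, fun κ x hx => h κ x ?_⟩
    rw [below_cons, value_all] at hx
    exact below_cons.2 ⟨(hx.1.trans (iInf_le _ _)).trans (M.value_inst _ _ _).ge, hx.2⟩
  | exR t d ih =>
    simp [CProof.rules] at h1 h2
    obtain ⟨A, hA, h⟩ := ih h1 h2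
    rcases Multiset.mem_cons.1 hA with rfl | hA
    · refine ⟨_, Multiset.mem_cons_self _ _, fun κ x hx => (h κ x hx).trans ?_⟩
      rw [value_inst, value_ex]
      exact le_iSup (M.bodyValue κ _) _
    · exact ⟨A, Multiset.mem_cons_of_mem hA, h⟩
  | exL c hc d ih =>
    simp [CProof.rules] at h1 h2
    obtain ⟨A, hA, h⟩ := ih h1 h2
    refine ⟨A, hA, fun κ x hx => ?_⟩
    rw [below_cons, value_ex] at hx
    -- `A` was chosen before `κ` and `x`, so the same formula serves for every value `e` of the
    -- eigenconstant.
    refine le_of_le_iSup_of_inf_le hx.1 fun e => ?_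
    exact (h _ _ (M.below_of_cons_inst_upd hc hx.2 e)).trans (M.value_upd κ e (hc.2 A hA)).le
  | allR c hc d ih =>
    simp [CProof.rules] at h1 h2
    obtain ⟨A, hA, h⟩ := ih h1 h2
    rcases Multiset.mem_cons.1 hA with rfl | hA
    · exact ⟨_, Multiset.mem_cons_self _ _, fun κ x hx =>
        M.bodyValue_le_of_forall_upd (hc.2 _ (Multiset.mem_cons_self _ _))
          fun e => h _ _ (hx.upd hc.1 e)⟩
    · exact ⟨A, Multiset.mem_cons_of_mem hA, h⟩

end Interp

/-! ### The invariants for conditions 3 and 4 -/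

namespace Interp

open FirstOrder.Language

variable {L : FirstOrder.Language} {V H D : Type*}

/-- Two interpretations of the constants agree on the constants that appear in `Γ`. -/
def AgreeOn (Γ : Multiset (Fml L V 0)) (κ κ' : L.Constants → D) : Prop :=
  ∀ c, (∃ A ∈ Γ, ConstIn c A) → κ c = κ' c

theorem AgreeOn.mono {Γ Γ' : Multiset (Fml L V 0)} {κ κ' : L.Constants → D}
    (h : AgreeOn Γ κ κ') (hΓ : ∀ c A, A ∈ Γ' → ConstIn c A → ∃ A ∈ Γ, ConstIn c A) :
    AgreeOn Γ' κ κ' :=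
  fun c ⟨A, hA, hc⟩ => h c (hΓ c A hA hc)

theorem AgreeOn.of_cons {Γ : Multiset (Fml L V 0)} {A B : Fml L V 0} {κ κ' : L.Constants → D}
    (h : AgreeOn (A ::ₘ Γ) κ κ') (hB : ∀ c, ConstIn c B → ConstIn c A) :
    AgreeOn (B ::ₘ Γ) κ κ' := by
  refine h.mono fun c C hC hc => ?_
  rcases Multiset.mem_cons.1 hC with rfl | hC
  · exact ⟨A, Multiset.mem_cons_self _ _, hB c hc⟩
  · exact ⟨C, Multiset.mem_cons_of_mem hC, hc⟩

theorem AgreeOn.tail {Γ : Multiset (Fml L V 0)} {A : Fml L V 0} {κ κ' : L.Constants → D}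
    (h : AgreeOn (A ::ₘ Γ) κ κ') : AgreeOn Γ κ κ' :=
  h.mono fun _ C hC hc => ⟨C, Multiset.mem_cons_of_mem hC, hc⟩

theorem constInTerm_subst {c : L.Constants} {W W' : Type*} (σ : W → L.Term W') (s : L.Term W)
    (h : ConstInTerm c (s.subst σ)) : ConstInTerm c s ∨ ∃ w, ConstInTerm c (σ w) := by
  induction s with
  | var w => exact Or.inr ⟨w, h⟩
  | func f ts ih =>
    rcases h with h | ⟨i, h⟩
    · exact Or.inl (Or.inl h)
    · exact (ih i h).imp (fun h => Or.inr ⟨i, h⟩) id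

theorem constInTerm_relabel {c : L.Constants} {W W' : Type*} (g : W → W') (s : L.Term W)
    (h : ConstInTerm c (s.relabel g)) : ConstInTerm c s := by
  induction s with
  | var w => exact h
  | func f ts ih =>
    rcases h with h | ⟨i, h⟩
    · exact Or.inl h
    · exact Or.inr ⟨i, ih i h⟩

theorem constInTerm_instTerm {c : L.Constants} {t : L.Term V} {n : ℕ}
    {s : L.Term (V ⊕ Fin (n + 1))} (h : ConstInTerm c (instTerm t s)) :
    ConstInTerm c s ∨ ConstInTerm c t := by
  refine (constInTerm_subst _ _ h).imp id ?_
  rintro ⟨v | i, hi⟩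
  · exact hi.elim
  · induction i using Fin.cases with
    | zero => exact constInTerm_relabel _ _ hi
    | succ i => exact hi.elim

theorem constIn_instAux {c : L.Constants} {t : L.Term V} {m : ℕ} (B : Fml L V m) :
    ∀ (n : ℕ) (h : m = n + 1), ConstIn c (B.instAux t n h) → ConstIn c B ∨ ConstInTerm c t := by
  induction B with
  | top => exact fun _ _ h => h.elim
  | bot => exact fun _ _ h => h.elim
  | atom p ts =>
    rintro n rfl ⟨i, hi⟩
    exact (constInTerm_instTerm hi).imp (fun h => ⟨i, h⟩) id
  | and B C ihB ihC | or B C ihB ihC | imp B C ihB ihC =>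
    rintro n h (h' | h')
    · exact (ihB n h h').imp Or.inl id
    · exact (ihC n h h').imp Or.inr id
  | ex B ih | all B ih => exact fun n h h' => ih _ _ h'

theorem constIn_inst_const {c c' : L.Constants} {n : ℕ} {B : Fml L V (n + 1)}
    (h : ConstIn c' (B.inst c.term)) : ConstIn c' B ∨ c' = c := by
  refine (constIn_instAux B n rfl h).imp id ?_
  rintro (h | ⟨i, -⟩)
  · simpa using h.symm
  · exact i.elim0

variable [Order.Frame H] (M : Interp L V H D)

/-- If neither `⊃`-R nor `∀`-L is used, then every case in which `Γ` holds is covered by cases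
in each of which some formula of `Δ` holds, whatever the values of the constants that do not
appear in `Γ`. -/
theorem le_of_forall_agreeOn {Γ Δ : Multiset (Fml L V 0)} (π : CProof Γ Δ)
    (h1 : Rule.impR ∉ π.rules) (h2 : Rule.allL ∉ π.rules) {κ : L.Constants → D} {x g : H}
    (h : M.Below κ x Γ)
    (hg : ∀ z ≤ x, ∀ A ∈ Δ, (∀ κ', AgreeOn Γ κ κ' → z ≤ M.value κ' A) → z ≤ g) : x ≤ g := by
  induction π generalizing κ x with
  | ax hax =>
    rcases hax with hT | ⟨A, -, hA, hA'⟩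
    · exact hg x le_rfl _ hT (by simp [value, val])
    · refine hg x le_rfl A hA' fun κ' hκ' => (h A hA).trans ?_
      exact (M.val_congr _ _ fun c hc => hκ' c ⟨A, hA, hc⟩).le
  | contrL d ih =>
    simp [CProof.rules] at h1 h2
    refine ih h1 h2 (by simpa [below_cons] using h) fun z hz A hA hk => hg z hz A hA fun κ' hκ' =>
      hk κ' (hκ'.mono fun c C hC hc => ⟨C, by simpa using hC, hc⟩)
  | contrR d ih =>
    simp [CProof.rules] at h1 h2
    exact ih h1 h2 h fun z hz A hA hk => hg z hz A (by simpa using hA) hk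
  | @botR Γ Δ E d ih =>
    simp [CProof.rules] at h1 h2
    refine ih h1 h2 h fun z hz A hA hk => ?_
    rcases Multiset.mem_cons.1 hA with rfl | hA
    · exact hg z hz _ (Multiset.mem_cons_self _ _) fun κ' hκ' => (hk κ' hκ').trans bot_le
    · exact hg z hz _ (Multiset.mem_cons_of_mem hA) hk
  | andL₁ d ih =>
    simp [CProof.rules] at h1 h2
    rw [below_cons, value_and, le_inf_iff] at h
    exact ih h1 h2 (below_cons.2 ⟨h.1.1, h.2⟩) fun z hz A hA hk => hg z hz A hA fun κ' hκ' =>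
      hk κ' (hκ'.of_cons fun _ => Or.inl)
  | andL₂ d ih =>
    simp [CProof.rules] at h1 h2
    rw [below_cons, value_and, le_inf_iff] at h
    exact ih h1 h2 (below_cons.2 ⟨h.1.2, h.2⟩) fun z hz A hA hk => hg z hz A hA fun κ' hκ' =>
      hk κ' (hκ'.of_cons fun _ => Or.inr)
  | orL d e ihd ihe =>
    simp [CProof.rules] at h1 h2
    rw [below_cons, value_or] at h
    refine le_of_le_sup_of_inf_le h.1 ?_ ?_
    · exact ihd h1.1 h2.1 (h.2.cons_inf le_rfl) fun z hz A hA hk =>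
        hg z (hz.trans inf_le_left) A hA fun κ' hκ' => hk κ' (hκ'.of_cons fun _ => Or.inl)
    · exact ihe h1.2 h2.2 (h.2.cons_inf le_rfl) fun z hz A hA hk =>
        hg z (hz.trans inf_le_left) A hA fun κ' hκ' => hk κ' (hκ'.of_cons fun _ => Or.inr)
  | andR d e ihd ihe =>
    simp [CProof.rules] at h1 h2
    refine ihd h1.1 h2.1 h fun z hz A hA hk => ?_
    rcases Multiset.mem_cons.1 hA with rfl | hA
    · refine ihe h1.2 h2.2 (h.mono hz) fun z' hz' A' hA' hk' => ?_
      rcases Multiset.mem_cons.1 hA' with rfl | hA'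
      · exact hg z' (hz'.trans hz) _ (Multiset.mem_cons_self _ _) fun κ' hκ' =>
          le_inf (hz'.trans (hk κ' hκ')) (hk' κ' hκ')
      · exact hg z' (hz'.trans hz) _ (Multiset.mem_cons_of_mem hA') hk'
    · exact hg z hz _ (Multiset.mem_cons_of_mem hA) hk
  | orR₁ d ih =>
    simp [CProof.rules] at h1 h2
    refine ih h1 h2 h fun z hz A hA hk => ?_
    rcases Multiset.mem_cons.1 hA with rfl | hA
    · exact hg z hz _ (Multiset.mem_cons_self _ _) fun κ' hκ' => (hk κ' hκ').trans le_sup_left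
    · exact hg z hz _ (Multiset.mem_cons_of_mem hA) hk
  | orR₂ d ih =>
    simp [CProof.rules] at h1 h2
    refine ih h1 h2 h fun z hz A hA hk => ?_
    rcases Multiset.mem_cons.1 hA with rfl | hA
    · exact hg z hz _ (Multiset.mem_cons_self _ _) fun κ' hκ' => (hk κ' hκ').trans le_sup_right
    · exact hg z hz _ (Multiset.mem_cons_of_mem hA) hk
  | impL d e ihd ihe =>
    simp [CProof.rules] at h1 h2
    rw [below_cons, value_imp] at h
    refine ihd h1.1 h2.1 h.2 fun z hz A hA hk => ?_
    rcases Multiset.mem_cons.1 hA with rfl | hA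
    -- In a case where `B` holds, modus ponens at `κ` itself yields the antecedent of the second
    -- premise, whose cases refine this one.
    · have hz' := (le_inf (hz.trans h.1) (hk κ fun _ _ => rfl)).trans himp_inf_le
      exact ihe h1.2 h2.2 (below_cons.2 ⟨hz', h.2.mono hz⟩) fun z' hz' A' hA' hk' =>
        hg z' (hz'.trans hz) A' (Multiset.mem_add.2 (Or.inr hA')) fun κ' hκ' =>
          hk' κ' (hκ'.of_cons fun _ => Or.inr)
    · exact hg z hz A (Multiset.mem_add.2 (Or.inl hA)) fun κ' hκ' => hk κ' hκ'.tail
  | impR d ih => simp [CProof.rules] at h1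
  | allL t d ih => simp [CProof.rules] at h2
  | exR t d ih =>
    simp [CProof.rules] at h1 h2
    refine ih h1 h2 h fun z hz A hA hk => ?_
    rcases Multiset.mem_cons.1 hA with rfl | hA
    · refine hg z hz _ (Multiset.mem_cons_self _ _) fun κ' hκ' => (hk κ' hκ').trans ?_
      rw [value_inst, value_ex]
      exact le_iSup (M.bodyValue κ' _) _
    · exact hg z hz _ (Multiset.mem_cons_of_mem hA) hk
  | @exL Γ Δ B c hc d ih =>
    simp [CProof.rules] at h1 h2
    rw [below_cons, value_ex] at h
    refine le_of_le_iSup_of_inf_le h.1 fun e => ?_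
    refine ih h1 h2 (M.below_of_cons_inst_upd hc h.2 e) fun z hz A hA hk => ?_
    refine hg z (hz.trans inf_le_left) A hA fun κ' hκ' => ?_
    rw [← M.value_upd κ' e (hc.2 A hA)]
    refine hk _ fun c' ⟨C, hC, hc'⟩ => ?_
    by_cases hcc : c' = c
    · subst hcc
      rw [upd_same, upd_same]
    · rw [upd_of_ne _ _ hcc, upd_of_ne _ _ hcc]
      apply hκ'
      rcases Multiset.mem_cons.1 hC with rfl | hC
      · exact ⟨_, Multiset.mem_cons_self _ _, (constIn_inst_const hc').resolve_right hcc⟩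
      · exact ⟨C, Multiset.mem_cons_of_mem hC, hc'⟩
  | allR c hc d ih =>
    simp [CProof.rules] at h1 h2
    refine ih h1 h2 h fun z hz A hA hk => ?_
    rcases Multiset.mem_cons.1 hA with rfl | hA
    · refine hg z hz _ (Multiset.mem_cons_self _ _) fun κ' hκ' => ?_
      -- The eigenconstant does not appear in `Γ`, so revaluing it preserves agreement on `Γ`. The
      -- case at hand thus covers all instances at once, which is the purpose of the uniformity over
      -- `κ'`.
      refine M.bodyValue_le_of_forall_upd (hc.2 _ (Multiset.mem_cons_self _ _)) fun e => hk _ ?_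
      rintro c' ⟨C, hC, hc'⟩
      have hcc : c' ≠ c := fun hcc => hc.1 C hC (hcc ▸ hc')
      rw [upd_of_ne _ _ hcc]
      exact hκ' c' ⟨C, hC, hc'⟩
    · exact hg z hz _ (Multiset.mem_cons_of_mem hA) hk

/-- `x` satisfies the antecedents on a path through the conjunctions, implications and universal
quantifiers of a formula to a formula that entails `g` or is a disjunction, an existential
formula or `⊥`. -/
def Path (κ : L.Constants → D) (x g : H) : {n : ℕ} → Fml L V n → (Fin n → D) → Prop
  | _, .top, _ => False
  | _, .bot, _ => True
  | _, .atom p ts, xs => M.val κ (.atom p ts) xs ≤ g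
  | _, .and B C, xs => Path κ x g B xs ∨ Path κ x g C xs
  | _, .or _ _, _ => True
  | _, .imp B C, xs => x ≤ M.val κ B xs ∧ Path κ x g C xs
  | _, .ex _, _ => True
  | n, .all B, xs => ∃ d : D, Path κ x g B (Fin.snoc xs d : Fin (n + 1) → D)

variable {M} in
theorem Path.mono {κ : L.Constants → D} {x y g : H} (hy : y ≤ x) {n : ℕ} {A : Fml L V n}
    {xs : Fin n → D} (h : M.Path κ x g A xs) : M.Path κ y g A xs := by
  induction A with
  | top | bot | or | ex | atom => exact h
  | and B C ihB ihC => exact Or.imp ihB ihC h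
  | imp B C ihB ihC => exact ⟨hy.trans h.1, ihC h.2⟩
  | all B ih =>
    obtain ⟨d, hd⟩ := h
    exact ⟨d, ih hd⟩

theorem path_congr {κ κ' : L.Constants → D} {x g : H} {n : ℕ} (A : Fml L V n) (xs : Fin n → D)
    (h : ∀ c, ConstIn c A → κ c = κ' c) : M.Path κ x g A xs ↔ M.Path κ' x g A xs := by
  induction A with
  | top | bot | or | ex => exact Iff.rfl
  | atom p ts => simp only [Path, M.val_congr _ xs h]
  | and B C ihB ihC =>
    exact or_congr (ihB xs fun c hc => h c (Or.inl hc)) (ihC xs fun c hc => h c (Or.inr hc))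
  | imp B C ihB ihC =>
    simp only [Path, M.val_congr B xs fun c hc => h c (Or.inl hc),
      ihC xs fun c hc => h c (Or.inr hc)]
  | all B ih => exact exists_congr fun d => ih _ h

theorem path_instAux (κ : L.Constants → D) (x g : H) (t : L.Term V) {m : ℕ} (B : Fml L V m) :
    ∀ (n : ℕ) (h : m = n + 1) (xs : Fin n → D), M.Path κ x g (B.instAux t n h) xs ↔
      M.Path κ x g B (fun i => (Fin.cons (M.tval κ M.vr t) xs : Fin (n + 1) → D) (Fin.cast h i)) := by
  induction B with
  | top | bot | or | ex => exact fun n h xs => Iff.rfl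
  | atom p ts =>
    intro n h xs
    simp only [Path, ← M.val_instAux κ t _ n h xs]
    rfl
  | and B C ihB ihC =>
    intro n h xs
    simp only [Fml.instAux, Path, ihB, ihC]
  | imp B C ihB ihC =>
    intro n h xs
    simp only [Fml.instAux, Path, val_instAux, ihC]
  | all B ih =>
    rintro n rfl xs
    simp only [Fml.instAux, Path, ih]
    simp only [Fin.cast_refl, id, ← Fin.cons_snoc_eq_snoc_cons]

theorem path_upd {κ : L.Constants → D} {x g : H} {c : L.Constants} (d : D) {n : ℕ}
    {A : Fml L V n} {xs : Fin n → D} (h : ¬ ConstIn c A) :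
    M.Path (upd κ c d) x g A xs ↔ M.Path κ x g A xs := by
  refine M.path_congr A xs fun c' hc' => ?_
  have hcc : c' ≠ c := fun hcc => h (hcc ▸ hc')
  exact upd_of_ne κ d hcc

theorem path_inst_upd {κ : L.Constants → D} {x g : H} {c : L.Constants} (d : D) {B : Fml L V 1}
    (h : ¬ ConstIn c B) :
    M.Path (upd κ c d) x g (B.inst c.term) ![] ↔ M.Path κ x g B ![d] := by
  rw [Fml.inst, path_instAux, tval_const, upd_same, M.path_upd d h,
    ← cons_empty ![] d]
  rfl

/-- Paths detect entailment: the hypothesis descends along `∧`, `⊃` and `∀`. At an atom it is used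
with `g` the value of the atom, and at `⊥`, `∨` and `∃`, where every `g` is admitted, with `g = ⊥`.
-/
theorem le_val_of_forall_path {κ : L.Constants → D} {n : ℕ} (A : Fml L V n) (xs : Fin n → D)
    {x : H} (h : ∀ y ≤ x, ∀ g, M.Path κ y g A xs → y ≤ g) : x ≤ M.val κ A xs := by
  induction A generalizing x with
  | top => exact le_top
  | bot | or | ex => exact (h x le_rfl ⊥ trivial).trans bot_le
  | atom p ts => exact h x le_rfl _ le_rfl
  | and B C ihB ihC =>
    exact le_inf (ihB xs fun y hy g hp => h y hy g (Or.inl hp))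
      (ihC xs fun y hy g hp => h y hy g (Or.inr hp))
  | imp B C ihB ihC =>
    exact le_himp_iff.2 <| ihC xs fun y hy g hp =>
      h y (hy.trans inf_le_left) g ⟨hy.trans inf_le_right, hp⟩
  | all B ih => exact le_iInf fun d => ih _ fun y hy g hp => h y hy g ⟨d, hp⟩

/-- If none of `⊃`-L, `∨`-R and `∃`-R is used, then `Γ` entails the common end of paths through
all the formulas of the succedent. -/
theorem le_of_forall_path {Γ Δ : Multiset (Fml L V 0)} (π : CProof Γ Δ)
    (h1 : Rule.impL ∉ π.rules) (h2 : Rule.orR ∉ π.rules) (h3 : Rule.exR ∉ π.rules)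
    {κ : L.Constants → D} {x g : H} (h : M.Below κ x Γ)
    (hg : ∀ A ∈ Δ, M.Path κ x g A ![]) : x ≤ g := by
  induction π generalizing κ x with
  | ax hax =>
    rcases hax with hT | ⟨A, hA0, hA, hA'⟩
    · exact (hg _ hT).elim
    · have hp := hg A hA'
      have hx := h A hA
      cases A with
      | bot => exact hx.trans bot_le
      | atom p ts => exact hx.trans hp
      | top | and | or | imp | ex | all => exact hA0.elim
  | contrL d ih =>
    simp [CProof.rules] at h1 h2 h3
    exact ih h1 h2 h3 (by simpa [below_cons] using h) hg
  | contrR d ih =>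
    simp [CProof.rules] at h1 h2 h3
    exact ih h1 h2 h3 h (by simpa using hg)
  | botR d ih =>
    simp [CProof.rules] at h1 h2 h3
    simp only [Multiset.forall_mem_cons] at hg ih
    exact ih h1 h2 h3 h ⟨trivial, hg.2⟩
  | andL₁ d ih =>
    simp [CProof.rules] at h1 h2 h3
    rw [below_cons, value_and, le_inf_iff] at h
    exact ih h1 h2 h3 (below_cons.2 ⟨h.1.1, h.2⟩) hg
  | andL₂ d ih =>
    simp [CProof.rules] at h1 h2 h3
    rw [below_cons, value_and, le_inf_iff] at h
    exact ih h1 h2 h3 (below_cons.2 ⟨h.1.2, h.2⟩) hg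
  | orL d e ihd ihe =>
    simp [CProof.rules] at h1 h2 h3
    rw [below_cons, value_or] at h
    exact le_of_le_sup_of_inf_le h.1
      (ihd h1.1 h2.1 h3.1 (h.2.cons_inf le_rfl) fun A hA => (hg A hA).mono inf_le_left)
      (ihe h1.2 h2.2 h3.2 (h.2.cons_inf le_rfl) fun A hA => (hg A hA).mono inf_le_left)
  | andR d e ihd ihe =>
    simp [CProof.rules] at h1 h2 h3
    simp only [Multiset.forall_mem_cons] at hg ihd ihe
    -- The path selects the premise to follow; the other premise is not needed.
    rcases hg.1 with hB | hC
    · exact ihd h1.1 h2.1 h3.1 h ⟨hB, hg.2⟩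
    · exact ihe h1.2 h2.2 h3.2 h ⟨hC, hg.2⟩
  | orR₁ d ih => simp [CProof.rules] at h2
  | orR₂ d ih => simp [CProof.rules] at h2
  | impL d e ihd ihe => simp [CProof.rules] at h1
  | impR d ih =>
    simp [CProof.rules] at h1 h2 h3
    simp only [Multiset.forall_mem_cons] at hg ih
    exact ih h1 h2 h3 (below_cons.2 ⟨hg.1.1, h⟩) ⟨hg.1.2, hg.2⟩
  | allL t d ih =>
    simp [CProof.rules] at h1 h2 h3
    rw [below_cons, value_all] at h
    exact ih h1 h2 h3
      (below_cons.2 ⟨(h.1.trans (iInf_le _ _)).trans (M.value_inst _ _ _).ge, h.2⟩) hg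
  | exR t d ih => simp [CProof.rules] at h3
  | exL c hc d ih =>
    simp [CProof.rules] at h1 h2 h3
    rw [below_cons, value_ex] at h
    refine le_of_le_iSup_of_inf_le h.1 fun e => ?_
    refine ih h1 h2 h3 (M.below_of_cons_inst_upd hc h.2 e) fun A hA => ?_
    exact ((M.path_upd e (hc.2 A hA)).2 (hg A hA)).mono inf_le_left
  | allR c hc d ih =>
    simp [CProof.rules] at h1 h2 h3
    simp only [Multiset.forall_mem_cons] at hg ih
    obtain ⟨⟨e, he⟩, hg⟩ := hg
    rw [snoc_empty] at he
    -- The element at which the path passes the quantifier becomes the value of the eigenconstant.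
    refine ih h1 h2 h3 (h.upd hc.1 e)
      ⟨(M.path_inst_upd e (hc.2 _ (Multiset.mem_cons_self _ _))).2 he, fun A hA => ?_⟩
    exact (M.path_upd e (hc.2 A (Multiset.mem_cons_of_mem hA))).2 (hg A hA)

/-- The four invariants are specialised to the succedent `{F}`. Condition 1 gives `x ≤ ⊥` by means
of `F ⊃ ⊥`, and the other three bound `x` by `F` from `Γ` alone. -/
theorem le_value_of_meetsSomeCondition {Γ : Multiset (Fml L V 0)} {F : Fml L V 0}
    (π : CProof Γ {F}) (hπ : MeetsSomeCondition π.rules) {κ : L.Constants → D} {x : H}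
    (h : M.Below κ x (Fml.imp F .bot ::ₘ Γ)) : x ≤ M.value κ F := by
  rw [below_cons] at h
  obtain ⟨hF, h⟩ := h
  rcases hπ with h1 | ⟨h1, h2⟩ | ⟨h1, h2⟩ | ⟨h1, h2, h3⟩
  · refine (M.le_bot_of_allR_notMem π h1 h ?_).trans bot_le
    simp only [Multiset.mem_singleton, forall_eq]
    exact le_himp_iff.1 hF
  · obtain ⟨A, hA, hA'⟩ := M.exists_le_value π h1 h2
    rw [Multiset.mem_singleton] at hA
    exact hA ▸ hA' κ x h
  · refine M.le_of_forall_agreeOn π h1 h2 h ?_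
    simp only [Multiset.mem_singleton, forall_eq]
    exact fun z _ hz => hz κ fun _ _ => rfl
  · refine M.le_val_of_forall_path F _ fun y hy g hp => ?_
    exact M.le_of_forall_path π h1 h2 h3 (h.mono hy) (by simpa using hp)

end Interp

/-! ### From a structural-rule-free calculus to **I**-proofs -/

open FirstOrder.Language

/-- Derivability in a variant of the calculus of **I**-proofs in which principal formulas on the
left are kept and the premises of `∃`-L and `∀`-R are available for all constants. -/
inductive IDer {L : FirstOrder.Language} {V : Type*} :
    Multiset (Fml L V 0) → Fml L V 0 → Prop
  | top {Γ} : IDer Γ .top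
  | ax {Γ A} (hA : IsBotOrAtom A) (h : A ∈ Γ) : IDer Γ A
  | botR {Γ E} (d : IDer Γ .bot) : IDer Γ E
  | andL₁ {Γ B E F} (h : .and B E ∈ Γ) (d : IDer (B ::ₘ Γ) F) : IDer Γ F
  | andL₂ {Γ B E F} (h : .and B E ∈ Γ) (d : IDer (E ::ₘ Γ) F) : IDer Γ F
  | orL {Γ B E F} (h : .or B E ∈ Γ) (d : IDer (B ::ₘ Γ) F) (e : IDer (E ::ₘ Γ) F) : IDer Γ F
  | andR {Γ B E} (d : IDer Γ B) (e : IDer Γ E) : IDer Γ (.and B E)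
  | orR₁ {Γ B E} (d : IDer Γ B) : IDer Γ (.or B E)
  | orR₂ {Γ B E} (d : IDer Γ E) : IDer Γ (.or B E)
  | impL {Γ B E F} (h : .imp B E ∈ Γ) (d : IDer Γ B) (e : IDer (E ::ₘ Γ) F) : IDer Γ F
  | impR {Γ B E} (d : IDer (B ::ₘ Γ) E) : IDer Γ (.imp B E)
  | allL {Γ F} {B : Fml L V 1} (t : L.Term V) (h : .all B ∈ Γ)
      (d : IDer (B.inst t ::ₘ Γ) F) : IDer Γ F
  | exR {Γ} {B : Fml L V 1} (t : L.Term V) (d : IDer Γ (B.inst t)) : IDer Γ (.ex B)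
  | exL {Γ F} {B : Fml L V 1} (h : .ex B ∈ Γ)
      (d : ∀ c : L.Constants, IDer (B.inst c.term ::ₘ Γ) F) : IDer Γ F
  | allR {Γ} {B : Fml L V 1} (d : ∀ c : L.Constants, IDer Γ (B.inst c.term)) : IDer Γ (.all B)

section Constants

variable {L : FirstOrder.Language} {V : Type*}

theorem finite_constInTerm {W : Type*} (s : L.Term W) :
    {c : L.Constants | ConstInTerm c s}.Finite := by
  induction s with
  | var w => exact Set.finite_empty
  | @func k f ts ih =>
    refine (Set.Finite.union ?_ (Set.finite_iUnion ih)).subset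
      (s := {c | (⟨k, f⟩ : Σ k, L.Functions k) = ⟨0, c⟩} ∪ ⋃ i, {c | ConstInTerm c (ts i)}) ?_
    · refine Set.Subsingleton.finite fun c hc c' hc' => ?_
      simpa using hc.symm.trans hc'
    · rintro c (h | ⟨i, h⟩)
      · exact Or.inl h
      · exact Or.inr (Set.mem_iUnion.2 ⟨i, h⟩)

theorem finite_constIn {n : ℕ} (A : Fml L V n) : {c : L.Constants | ConstIn c A}.Finite := by
  induction A with
  | top | bot => exact Set.finite_empty
  | atom p ts =>
    exact (Set.finite_iUnion fun i => finite_constInTerm (ts i)).subset fun c ⟨i, h⟩ =>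
      Set.mem_iUnion.2 ⟨i, h⟩
  | and B C ihB ihC | or B C ihB ihC | imp B C ihB ihC => exact ihB.union ihC
  | ex B ih | all B ih => exact ih

theorem exists_freshFor [Infinite L.Constants] (Γ Δ : Multiset (Fml L V 0)) :
    ∃ c : L.Constants, FreshFor c Γ Δ := by
  have hfin : ∀ Θ : Multiset (Fml L V 0), {c : L.Constants | ∃ A ∈ Θ, ConstIn c A}.Finite := by
    intro Θ
    induction Θ using Multiset.induction with
    | empty => simp
    | cons A Θ ih => simpa [Set.ofPred_or] using (finite_constIn A).union ih
  obtain ⟨c, hc⟩ := ((hfin Γ).union (hfin Δ)).exists_notMem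
  simp only [Set.mem_union, Set.mem_ofPred_eq, not_or, not_exists, not_and] at hc
  exact ⟨c, hc⟩

end Constants

namespace IDer

variable {L : FirstOrder.Language} {V : Type*}

/-- Inclusion ignores multiplicities, so this is weakening and contraction together. No
eigenconstant has to be renamed, because `∃`-L and `∀`-R have premises for all constants. -/
theorem weaken {Γ Γ' : Multiset (Fml L V 0)} {F : Fml L V 0} (d : IDer Γ F) (h : Γ ⊆ Γ') :
    IDer Γ' F := by
  induction d generalizing Γ' with
  | top => exact .top
  | ax hA hmem => exact .ax hA (h hmem)
  | botR _ ih => exact .botR (ih h)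
  | andL₁ hmem _ ih => exact .andL₁ (h hmem) (ih (Multiset.cons_subset_cons h))
  | andL₂ hmem _ ih => exact .andL₂ (h hmem) (ih (Multiset.cons_subset_cons h))
  | orL hmem _ _ ih ih' =>
    exact .orL (h hmem) (ih (Multiset.cons_subset_cons h)) (ih' (Multiset.cons_subset_cons h))
  | andR _ _ ih ih' => exact .andR (ih h) (ih' h)
  | orR₁ _ ih => exact .orR₁ (ih h)
  | orR₂ _ ih => exact .orR₂ (ih h)
  | impL hmem _ _ ih ih' => exact .impL (h hmem) (ih h) (ih' (Multiset.cons_subset_cons h))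
  | impR _ ih => exact .impR (ih (Multiset.cons_subset_cons h))
  | allL t hmem _ ih => exact .allL t (h hmem) (ih (Multiset.cons_subset_cons h))
  | exR t _ ih => exact .exR t (ih h)
  | exL hmem _ ih => exact .exL (h hmem) fun c => ih c (Multiset.cons_subset_cons h)
  | allR _ ih => exact .allR fun c => ih c h

/-- A kept principal formula is duplicated by contr-L before the left rule is applied. Among the
premises for all constants, one uses a constant fresh for the conclusion, since there are infinitely
many constants. -/
theorem iProvable [Infinite L.Constants] {Γ : Multiset (Fml L V 0)} {F : Fml L V 0}
    (d : IDer Γ F) : IProvable Γ F := by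
  have contr : ∀ {Γ : Multiset (Fml L V 0)} {A F : Fml L V 0}, A ∈ Γ →
      IProvable (A ::ₘ Γ) F → IProvable Γ F := by
    rintro Γ A F hA ⟨π, hπ⟩
    obtain ⟨Γ, rfl⟩ := Multiset.exists_cons_of_mem hA
    exact ⟨.contrL π, rfl, hπ⟩
  induction d with
  | top => exact ⟨.ax (Or.inl (by simp)), by simp [CProof.IsIProof]⟩
  | @ax Γ A hA hmem => exact ⟨.ax (Or.inr ⟨A, hA, hmem, by simp⟩), by simp [CProof.IsIProof]⟩
  | botR _ ih =>
    obtain ⟨π, hπ⟩ := ih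
    exact ⟨.botR π, rfl, hπ⟩
  | andL₁ hmem _ ih =>
    obtain ⟨π, hπ⟩ := ih
    exact contr hmem ⟨.andL₁ π, rfl, hπ⟩
  | andL₂ hmem _ ih =>
    obtain ⟨π, hπ⟩ := ih
    exact contr hmem ⟨.andL₂ π, rfl, hπ⟩
  | orL hmem _ _ ih ih' =>
    obtain ⟨π, hπ⟩ := ih
    obtain ⟨π', hπ'⟩ := ih'
    exact contr hmem ⟨.orL π π', rfl, hπ, hπ'⟩
  | andR _ _ ih ih' =>
    obtain ⟨π, hπ⟩ := ih
    obtain ⟨π', hπ'⟩ := ih'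
    exact ⟨.andR π π', rfl, hπ, hπ'⟩
  | orR₁ _ ih =>
    obtain ⟨π, hπ⟩ := ih
    exact ⟨.orR₁ π, rfl, hπ⟩
  | orR₂ _ ih =>
    obtain ⟨π, hπ⟩ := ih
    exact ⟨.orR₂ π, rfl, hπ⟩
  | @impL Γ B E F hmem _ _ ih ih' =>
    obtain ⟨π, hπ⟩ := ih
    obtain ⟨π', hπ'⟩ := ih'
    refine contr hmem ?_
    -- `⊃`-L concatenates the side succedents of its premises; here these are `0` and `{F}`.
    have : IProvable (Fml.imp B E ::ₘ Γ) F ↔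
        ∃ π : CProof (Fml.imp B E ::ₘ Γ) (0 + {F}), π.IsIProof := by rw [zero_add]; rfl
    exact this.2 ⟨.impL π π', rfl, hπ, hπ'⟩
  | impR _ ih =>
    obtain ⟨π, hπ⟩ := ih
    exact ⟨.impR π, rfl, hπ⟩
  | allL t hmem _ ih =>
    obtain ⟨π, hπ⟩ := ih
    exact contr hmem ⟨.allL t π, rfl, hπ⟩
  | exR t _ ih =>
    obtain ⟨π, hπ⟩ := ih
    exact ⟨.exR t π, rfl, hπ⟩
  | @exL Γ F B hmem _ ih =>
    obtain ⟨c, hc⟩ := exists_freshFor (Fml.ex B ::ₘ Γ) {F}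
    obtain ⟨π, hπ⟩ := ih c
    exact contr hmem ⟨.exL c hc π, rfl, hπ⟩
  | @allR Γ B _ ih =>
    obtain ⟨c, hc⟩ := exists_freshFor Γ (Fml.all B ::ₘ 0)
    obtain ⟨π, hπ⟩ := ih c
    exact ⟨.allR c hc π, rfl, hπ⟩

end IDer

/-! ### Cut-free completeness by a term model in a frame of closed sets -/

/-- Antecedents of sequents, ordered so that stronger antecedents are smaller. -/
def Ctx (L : FirstOrder.Language) (V : Type*) := Multiset (Fml L V 0)

namespace Ctx

variable {L : FirstOrder.Language} {V : Type*}

instance : Preorder (Ctx L V) where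
  le Γ Γ' := Multiset.Subset (α := Fml L V 0) Γ' Γ
  le_refl Γ := Multiset.Subset.refl (α := Fml L V 0) Γ
  le_trans _ _ _ h h' := Multiset.Subset.trans (α := Fml L V 0) h' h

/-- The union of two antecedents. -/
def union (Γ Γ' : Multiset (Fml L V 0)) : Multiset (Fml L V 0) := Γ + Γ'

theorem mem_union {Γ Γ' : Multiset (Fml L V 0)} {A : Fml L V 0} :
    A ∈ union Γ Γ' ↔ A ∈ Γ ∨ A ∈ Γ' := Multiset.mem_add

theorem iDer_union_assoc {Γ Γ' Δ : Multiset (Fml L V 0)} {A : Fml L V 0}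
    (h : IDer (union (union Γ Γ') Δ) A) : IDer (union Γ (union Γ' Δ)) A :=
  h.weaken fun B hB => by simpa only [mem_union, or_assoc] using hB

theorem iDer_union_swap {Γ Γ' Δ : Multiset (Fml L V 0)} {A : Fml L V 0}
    (h : IDer (union Γ (union Γ' Δ)) A) : IDer (union Γ' (union Γ Δ)) A :=
  h.weaken fun B hB => by
    simp only [mem_union] at hB ⊢
    tauto

theorem iDer_union_self {Γ Δ : Multiset (Fml L V 0)} {A : Fml L V 0}
    (h : IDer (union Γ (union Γ Δ)) A) : IDer (union Γ Δ) A :=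
  h.weaken fun B hB => by
    simp only [mem_union] at hB ⊢
    tauto

/-- The antecedents `Γ` for which `Γ, Δ ⟶ A` is derivable. -/
def derivable (Δ : Multiset (Fml L V 0)) (A : Fml L V 0) : LowerSet (Ctx L V) where
  carrier := {Γ | IDer (union Γ Δ) A}
  lower' _ _ h hd := IDer.weaken hd fun _ hB =>
    mem_union.2 ((mem_union.1 hB).imp (fun hB => h hB) id)

theorem mem_derivable {Γ : Ctx L V} {Δ : Multiset (Fml L V 0)} {A : Fml L V 0} :
    Γ ∈ derivable Δ A ↔ IDer (union Γ Δ) A := Iff.of_eq rfl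

/-- The nucleus whose closed sets are the intersections of sets `Ctx.derivable Δ A`. -/
def nucleus (L : FirstOrder.Language) (V : Type*) : Nucleus (LowerSet (Ctx L V)) where
  toFun X :=
    { carrier := {Γ | ∀ Δ A, X ≤ derivable Δ A → IDer (union Γ Δ) A}
      lower' := fun _ _ h hd Δ A hX => (derivable Δ A).lower h (hd Δ A hX) }
  map_inf' X Y := by
    apply le_antisymm
    · exact le_inf (fun Γ h Δ A hX => h Δ A (inf_le_left.trans hX))
        (fun Γ h Δ A hY => h Δ A (inf_le_right.trans hY))
    · rintro Γ ⟨hX, hY⟩ Δ A hXY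
      -- The members of `X` and of `Y` are absorbed into the side context one at a time. Weakening
      -- puts `Ξ ∪ Θ` into both sets, and contraction finally merges the two copies of `Γ`.
      have h1 : Y ≤ derivable (union Γ Δ) A := by
        intro Θ hΘ
        have h2 : X ≤ derivable (union Θ Δ) A := by
          intro Ξ hΞ
          have h3 : (union Ξ Θ : Ctx L V) ∈ X ⊓ Y :=
            ⟨X.lower (fun _ hB => mem_union.2 (Or.inl hB)) hΞ,
              Y.lower (fun _ hB => mem_union.2 (Or.inr hB)) hΘ⟩
          exact iDer_union_assoc (mem_derivable.1 (hXY h3))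
        exact iDer_union_swap (hX _ _ h2)
      exact iDer_union_self (hY _ _ h1)
  idempotent' X Γ h Δ A hX := h Δ A fun _ hΘ => hΘ Δ A hX
  le_apply' X Γ h Δ A hX := hX h

/-- The frame of closed sets of antecedents. -/
abbrev Closed (L : FirstOrder.Language) (V : Type*) := Set.range (nucleus L V)

theorem mem_of_forall {X : Closed L V} {Γ : Ctx L V}
    (h : ∀ Δ A, X.1 ≤ derivable Δ A → IDer (union Γ Δ) A) : Γ ∈ X.1 := by
  rw [← (nucleus L V).mem_range.1 X.2]
  exact h

/-- The closed set of antecedents that are derivable with `Δ` and `A`. -/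
def basic (Δ : Multiset (Fml L V 0)) (A : Fml L V 0) : Closed L V :=
  ⟨derivable Δ A, (nucleus L V).mem_range.2
    (le_antisymm (fun _ h => h Δ A le_rfl) (nucleus L V).le_apply)⟩

theorem mem_basic_zero {Γ : Ctx L V} {A : Fml L V 0} : Γ ∈ (basic 0 A).1 ↔ IDer Γ A :=
  Iff.of_eq (congrArg (IDer (L := L) (V := V) · A) (add_zero (M := Multiset (Fml L V 0)) Γ))

/-- The term model. -/
def termModel (L : FirstOrder.Language) (V : Type*) : Interp L V (Closed L V) (L.Term V) where
  fn f ts := .func f ts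
  rel p ts := basic 0 (.atom p fun i => (ts i).relabel Sum.inl)
  vr := .var

theorem tval_termModel {W : Type*} (e : W → L.Term V) (s : L.Term W) :
    (termModel L V).tval Constants.term e s = s.subst e := by
  induction s with
  | var w => rfl
  | @func k f ts ih =>
    cases k with
    | zero =>
      simp only [Interp.tval, Interp.app, Term.subst, Constants.term]
      congr 1
      exact Subsingleton.elim _ _
    | succ k =>
      simp only [Interp.tval, Interp.app, Term.subst, ih]
      rfl

theorem subst_var {W : Type*} (s : L.Term W) : s.subst Term.var = s := by
  induction s with
  | var w => rfl
  | func f ts ih => simp [Term.subst, ih]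

theorem tval_termModel_var (t : L.Term V) :
    (termModel L V).tval Constants.term (termModel L V).vr t = t := by
  rw [tval_termModel]
  exact subst_var t

theorem relabel_subst_elim (s : L.Term (V ⊕ Fin 0)) :
    (s.subst (Sum.elim Term.var ![])).relabel Sum.inl = s := by
  induction s with
  | var w =>
    rcases w with v | i
    · rfl
    · exact i.elim0
  | func f ts ih => simp [Term.subst, Term.relabel, ih]

/-- The value of a formula in the term model. -/
abbrev tmValue (A : Fml L V 0) : Closed L V := (termModel L V).value Constants.term A

theorem tmValue_atom {k : ℕ} (p : L.Relations k) (ts : Fin k → L.Term (V ⊕ Fin 0)) :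
    tmValue (.atom p ts) = basic 0 (.atom p ts) := by
  simp only [Interp.val, tval_termModel]
  simp only [termModel, relabel_subst_elim]

theorem bodyValue_termModel (B : Fml L V 1) (t : L.Term V) :
    (termModel L V).bodyValue Constants.term B t = tmValue (B.inst t) := by
  rw [tmValue, Interp.value_inst, tval_termModel_var]

theorem tmValue_ex (B : Fml L V 1) : tmValue (.ex B) = ⨆ t, tmValue (B.inst t) := by
  simp only [Interp.value_ex, bodyValue_termModel]

theorem tmValue_all (B : Fml L V 1) : tmValue (.all B) = ⨅ t, tmValue (B.inst t) := by
  simp only [Interp.value_all, bodyValue_termModel]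

/-- The closed set generated by an antecedent. -/
def principal (Γ : Ctx L V) : Closed L V := (nucleus L V).restrict (LowerSet.Iic Γ)

theorem principal_le {Γ : Ctx L V} {X : Closed L V} : principal Γ ≤ X ↔ Γ ∈ X.1 := by
  rw [principal, ← LowerSet.Iic_le]
  exact (nucleus L V).giRestrict.gc _ _

theorem principal_union (Γ Γ' : Multiset (Fml L V 0)) :
    principal (union Γ Γ') = principal (L := L) (V := V) Γ ⊓ principal Γ' := by
  refine (congrArg (nucleus L V).restrict ?_).trans (map_inf (nucleus L V).restrict _ _)
  ext Θ
  refine ⟨fun h => ⟨fun B hB => h (mem_union.2 (Or.inl hB)),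
    fun B hB => h (mem_union.2 (Or.inr hB))⟩, fun h B hB => ?_⟩
  exact (mem_union.1 hB).elim (fun hB => h.1 hB) (fun hB => h.2 hB)

end Ctx

namespace Fml

variable {L : FirstOrder.Language} {V : Type*}

/-- The number of logical symbols in a formula. -/
def size : {n : ℕ} → Fml L V n → ℕ
  | _, .top => 0
  | _, .bot => 0
  | _, .atom _ _ => 0
  | _, .and B C => B.size + C.size + 1
  | _, .or B C => B.size + C.size + 1
  | _, .imp B C => B.size + C.size + 1
  | _, .ex B => B.size + 1
  | _, .all B => B.size + 1

theorem size_instAux (t : L.Term V) {m : ℕ} (B : Fml L V m) :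
    ∀ (n : ℕ) (h : m = n + 1), (B.instAux t n h).size = B.size := by
  induction B with
  | top | bot | atom => exact fun _ _ => rfl
  | and B C ihB ihC | or B C ihB ihC | imp B C ihB ihC =>
    intro n h
    simp only [instAux, size, ihB, ihC]
  | ex B ih | all B ih =>
    intro n h
    simp only [instAux, size, ih]

theorem size_inst (t : L.Term V) {n : ℕ} (B : Fml L V (n + 1)) : (B.inst t).size = B.size :=
  size_instAux t B n rfl

end Fml

namespace Ctx

variable {L : FirstOrder.Language} {V : Type*}

/-- A formula belongs to an antecedent in the value of the formula, and the antecedents in the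
value of a formula derive it. -/
theorem tmValue_spec (m : ℕ) : ∀ A : Fml L V 0, A.size = m →
    (∀ Γ : Multiset (Fml L V 0), A ∈ Γ → principal Γ ≤ tmValue A) ∧ tmValue A ≤ basic 0 A := by
  -- The induction is on size, because instances `B.inst t` are not structural subterms of a
  -- quantified formula.
  induction m using Nat.strong_induction_on with
  | _ m ih =>
    have mem : ∀ {A : Fml L V 0} {Γ Δ : Multiset (Fml L V 0)} {F : Fml L V 0}, A.size < m →
        (tmValue A).1 ≤ derivable Δ F → A ∈ Γ → IDer (union Γ Δ) F := fun {A Γ Δ F} hA h hΓ =>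
      mem_derivable.1 (h (principal_le.1 ((ih _ hA A rfl).1 Γ hΓ)))
    have der : ∀ {A : Fml L V 0} {Γ : Multiset (Fml L V 0)}, A.size < m →
        principal Γ ≤ tmValue A → IDer Γ A := fun {A Γ} hA h =>
      mem_basic_zero.1 (principal_le.1 (h.trans (ih _ hA A rfl).2))
    have left : ∀ {A : Fml L V 0} {Γ Δ : Multiset (Fml L V 0)}, A ∈ Γ → A ∈ union Γ Δ :=
      fun h => mem_union.2 (Or.inl h)
    have cons : ∀ {A F : Fml L V 0} {Γ Δ : Multiset (Fml L V 0)},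
        IDer (union (A ::ₘ Γ) Δ) F → IDer (A ::ₘ union Γ Δ) F := fun {A F Γ Δ} h => by
      rwa [union, Multiset.cons_add] at h
    rintro A rfl
    cases A with
    | top => exact ⟨fun Γ _ => le_top, fun Γ _ => mem_basic_zero.2 .top⟩
    | bot =>
      refine ⟨fun Γ h => principal_le.2 <| mem_of_forall fun Δ F _ => ?_, bot_le⟩
      exact .botR (.ax trivial (left h))
    | atom p ts =>
      rw [tmValue_atom]
      exact ⟨fun Γ h => principal_le.2 (mem_basic_zero.2 (.ax trivial h)), le_rfl⟩
    | and B C =>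
      have hB : B.size < (Fml.and B C).size := by simp only [Fml.size]; omega
      have hC : C.size < (Fml.and B C).size := by simp only [Fml.size]; omega
      constructor
      · refine fun Γ h => le_inf ?_ ?_ <;>
          refine principal_le.2 <| mem_of_forall fun Δ F hX => ?_
        · exact .andL₁ (left h) (cons (mem hB hX (Multiset.mem_cons_self _ _)))
        · exact .andL₂ (left h) (cons (mem hC hX (Multiset.mem_cons_self _ _)))
      · intro Γ h
        have h' := principal_le.2 h
        exact mem_basic_zero.2 (.andR (der hB (h'.trans inf_le_left)) (der hC (h'.trans inf_le_right)))
    | or B C =>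
      have hB : B.size < (Fml.or B C).size := by simp only [Fml.size]; omega
      have hC : C.size < (Fml.or B C).size := by simp only [Fml.size]; omega
      constructor
      · refine fun Γ h => principal_le.2 <| mem_of_forall fun Δ F hX => ?_
        have hX' : tmValue (.or B C) ≤ basic Δ F := hX
        exact .orL (left h)
          (cons (mem hB (le_sup_left.trans hX' : tmValue B ≤ _) (Multiset.mem_cons_self _ _)))
          (cons (mem hC (le_sup_right.trans hX' : tmValue C ≤ _) (Multiset.mem_cons_self _ _)))
      · refine sup_le (fun Γ h => ?_) (fun Γ h => ?_)
        · exact mem_basic_zero.2 (.orR₁ (der hB (principal_le.2 h)))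
        · exact mem_basic_zero.2 (.orR₂ (der hC (principal_le.2 h)))
    | imp B C =>
      have hB : B.size < (Fml.imp B C).size := by simp only [Fml.size]; omega
      have hC : C.size < (Fml.imp B C).size := by simp only [Fml.size]; omega
      constructor
      -- Interchanging the arguments of the meet allows the value of `B` to be tested on a single
      -- member `Θ`. The meet of the closed sets generated by `Γ` and `Θ` is the one generated by
      -- their union, to which `⊃`-L applies.
      · refine fun Γ h => le_himp_iff.2 ?_
        rw [inf_comm, ← le_himp_iff]
        intro (Θ : Multiset (Fml L V 0)) hΘ
        refine principal_le.1 (le_himp_iff.2 ?_)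
        rw [inf_comm, ← principal_union]
        refine principal_le.2 <| mem_of_forall fun Δ F hX => ?_
        refine .impL (left (left h)) ((der hB (principal_le.2 hΘ)).weaken fun E hE => ?_)
          (cons (mem hC hX (Multiset.mem_cons_self _ _)))
        exact left (mem_union.2 (Or.inr hE))
      · intro (Γ : Multiset (Fml L V 0)) h
        refine mem_basic_zero.2 (.impR (der hC ?_))
        have h' : principal (union {B} Γ) ≤ tmValue C := by
          rw [principal_union, inf_comm]
          refine (inf_le_inf (principal_le.2 h)
            ((ih _ hB B rfl).1 _ (Multiset.mem_singleton_self B))).trans ?_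
          exact himp_inf_le
        exact h'
    | ex B =>
      have hB : ∀ t, (B.inst t).size < (Fml.ex B).size := fun t => by
        simp only [Fml.size, Fml.size_inst]
        omega
      rw [tmValue_ex]
      constructor
      · refine fun Γ h => principal_le.2 <| mem_of_forall fun Δ F hX => ?_
        have hX' : (⨆ t, tmValue (B.inst t)) ≤ basic Δ F := hX
        exact .exL (left h) fun c => cons (mem (hB c.term)
          ((le_iSup (fun t => tmValue (B.inst t)) c.term).trans hX') (Multiset.mem_cons_self _ _))
      · exact iSup_le fun t Γ h => mem_basic_zero.2 (.exR t (der (hB t) (principal_le.2 h)))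
    | all B =>
      have hB : ∀ t, (B.inst t).size < (Fml.all B).size := fun t => by
        simp only [Fml.size, Fml.size_inst]
        omega
      rw [tmValue_all]
      constructor
      · refine fun Γ h => le_iInf fun t => principal_le.2 <| mem_of_forall fun Δ F hX => ?_
        exact .allL t (left h) (cons (mem (hB t) hX (Multiset.mem_cons_self _ _)))
      · intro Γ h
        exact mem_basic_zero.2 (.allR fun c =>
          der (hB c.term) ((principal_le.2 h).trans (iInf_le _ c.term)))

/-- Completeness of the term model. -/
theorem iDer_of_forall_le {Γ : Multiset (Fml L V 0)} {F : Fml L V 0}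
    (h : ∀ x, (termModel L V).Below Constants.term x Γ → x ≤ tmValue F) : IDer Γ F :=
  mem_basic_zero.1 <| principal_le.1 <|
    (h (principal Γ) fun A hA => (tmValue_spec _ A rfl).1 Γ hA).trans (tmValue_spec _ F rfl).2

end Ctx

/-- The **C**-proof is evaluated directly in the term model, and completeness turns the resulting
inequality into a derivation. -/
theorem iProvable_of_meetsSomeCondition {L : FirstOrder.Language} {V : Type*}
    [Infinite L.Constants] {Γ : Multiset (Fml L V 0)} {F : Fml L V 0} (π : CProof Γ {F})
    (hπ : MeetsSomeCondition π.rules) : IProvable (Fml.imp F Fml.bot ::ₘ Γ) F :=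
  (Ctx.iDer_of_forall_le fun _ hx =>
    (Ctx.termModel L V).le_value_of_meetsSomeCondition π hπ hx).iProvable

/-! ### The countermodel in the open sets of the real line -/

open TopologicalSpace (Opens)

/-- The open set of all points but one. -/
def puncture (x : ℝ) : Opens ℝ := ⟨{x}ᶜ, isOpen_compl_singleton⟩

theorem mem_puncture {x y : ℝ} : y ∈ puncture x ↔ y ≠ x := Iff.rfl

/-- A nonempty open set would contain a point of `s`, and that point is removed by its own member of
the family. -/
theorem iInf_eq_bot_of_dense {s : Set ℝ} (hs : Dense s) {f : ℝ → Opens ℝ}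
    (hf : ∀ x ∈ s, f x ≤ puncture x) : ⨅ x, f x = ⊥ := by
  by_contra hne
  obtain ⟨x, hx, hxs⟩ := hs.inter_open_nonempty _ (⨅ x, f x).isOpen
    ((Opens.ne_bot_iff_nonempty _).1 hne)
  exact mem_puncture.1 (hf x hxs ((iInf_le f x : _ ≤ _) hx)) rfl

/-- The complement of a point is dense, so only the empty open set is disjoint from it. -/
theorem puncture_himp_bot (x : ℝ) : puncture x ⇨ ⊥ = ⊥ := by
  by_contra hne
  obtain ⟨y, hy, hyx⟩ := (dense_compl_singleton x).inter_open_nonempty _ (puncture x ⇨ ⊥).isOpen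
    ((Opens.ne_bot_iff_nonempty _).1 hne)
  exact (himp_inf_le : (puncture x ⇨ ⊥) ⊓ puncture x ≤ ⊥) ⟨hy, hyx⟩

open Classical in
/-- The interpretation of the binary predicates in the countermodel. -/
noncomputable def counterRel (x z : ℝ) : Opens ℝ :=
  if z = 0 then if Irrational x then ⊤ else puncture x
  else if z = 1 then if Irrational x then puncture x else ⊤
  else ⊥

/-- The rationals are removed at `z = 0` and the irrationals at `z = 1`, both dense. The value `⊥`
at every other `z` makes `∃ z, ∀ x, R(x, z)` false as well. -/
theorem iInf_counterRel (z : ℝ) : ⨅ x, counterRel x z = ⊥ := by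
  by_cases h0 : z = 0
  · refine iInf_eq_bot_of_dense Rat.denseRange_cast ?_
    rintro _ ⟨q, rfl⟩
    simp [counterRel, h0]
  · by_cases h1 : z = 1
    · refine iInf_eq_bot_of_dense dense_irrational fun x hx => ?_
      have : Irrational x := hx
      simp [counterRel, h1, this]
    · simp [counterRel, h0, h1]

/-- Both terms are proper only if `x` is rational and `y` irrational. Then `x ≠ y`, and the
complements of two distinct points cover the line. -/
theorem counterRel_sup (x y : ℝ) : counterRel x 0 ⊔ counterRel y 1 = ⊤ := by
  by_cases hx : Irrational x <;> by_cases hy : Irrational y <;> simp [counterRel, hx, hy]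
  ext z
  simp only [Opens.coe_sup, Set.mem_union, SetLike.mem_coe, mem_puncture, Opens.coe_top,
    Set.mem_univ, iff_true]
  by_contra! h
  exact hx (h.1 ▸ h.2 ▸ hy)

theorem counterRel_himp_bot (x : ℝ) : counterRel x 0 ⇨ ⊥ = ⊥ := by
  by_cases hx : Irrational x <;> simp only [counterRel, hx, if_true, if_false, puncture_himp_bot]
  exact top_himp

section Countermodel

variable {L : FirstOrder.Language} {V : Type*}

/-- The countermodel, with values in the open sets of the real line. -/
noncomputable def counterModel (L : FirstOrder.Language) (V : Type*) :
    Interp L V (Opens ℝ) ℝ where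
  fn _ _ := 0
  rel {k} _ ts := if h : k = 2 then counterRel (ts (Fin.cast h.symm 0)) (ts (Fin.cast h.symm 1))
    else ⊥
  vr _ := 0

open Classical in
/-- The interpretation of the constants in the countermodel. -/
noncomputable def counterConst (b : L.Constants) : L.Constants → ℝ := fun c => if c = b then 1 else 0

/-- An atomic formula with a binary predicate. -/
def binAtom {n : ℕ} (R : L.Relations 2) (s t : L.Term (V ⊕ Fin n)) : Fml L V n := .atom R ![s, t]

variable (R : L.Relations 2) (a b : L.Constants)

@[simp] theorem inst_binAtom (u : L.Term V) {n : ℕ} (s t : L.Term (V ⊕ Fin (n + 1))) :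
    (binAtom R s t).inst u = binAtom R (instTerm u s) (instTerm u t) := by
  rw [binAtom, Fml.inst_atom, binAtom]
  congr 1
  funext i
  fin_cases i <;> rfl

@[simp] theorem relabel_const (c : L.Constants) {W W' : Type*} (g : W → W') :
    (c.term : L.Term W).relabel g = c.term :=
  congrArg (Term.func c) (Subsingleton.elim _ _)

@[simp] theorem instTerm_const (u : L.Term V) (c : L.Constants) (n : ℕ) :
    instTerm u (c.term : L.Term (V ⊕ Fin (n + 1))) = c.term :=
  congrArg (Term.func c) (Subsingleton.elim _ _)

@[simp] theorem instTerm_zero (u : L.Term V) (n : ℕ) :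
    instTerm u (Term.var (Sum.inr 0) : L.Term (V ⊕ Fin (n + 1))) = u.relabel Sum.inl := rfl

@[simp] theorem instTerm_one (u : L.Term V) (n : ℕ) :
    instTerm u (Term.var (Sum.inr 1) : L.Term (V ⊕ Fin (n + 2))) = Term.var (Sum.inr 0) := rfl

@[simp] theorem constInTerm_const {c c' : L.Constants} {W : Type*} :
    ConstInTerm c (c'.term : L.Term W) ↔ c' = c := by
  constructor
  · rintro (h | ⟨i, -⟩)
    · simpa using h
    · exact i.elim0
  · rintro rfl
    exact Or.inl rfl

@[simp] theorem constIn_binAtom {c : L.Constants} {n : ℕ} (s t : L.Term (V ⊕ Fin n)) :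
    ConstIn c (binAtom R s t) ↔ ConstInTerm c s ∨ ConstInTerm c t := by
  simp [binAtom, ConstIn, Fin.exists_fin_two]

@[simp] theorem constInTerm_var {c : L.Constants} {W : Type*} (w : W) :
    ConstInTerm c (Term.var w : L.Term W) ↔ False := Iff.rfl

/-- `R(xᵢ, a)`. -/
def varAtom {n : ℕ} (i : Fin n) : Fml L V n := binAtom R (.var (Sum.inr i)) a.term

/-- `∀ x, R(x, a)`. -/
def allAtom {n : ℕ} : Fml L V n := .all (varAtom R a (Fin.last n))

/-- `∀ x y, R(x, a) ∨ R(y, b)`. -/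
def allOr : Fml L V 0 := .all (.all (.or (varAtom R a 0) (varAtom R b 1)))

/-- `∀ x, ((R(x, a) ⊃ ⊥) ⊃ R(x, a)) ⊃ R(x, a)`. -/
def allPeirce : Fml L V 0 :=
  .all (.imp (.imp (.imp (varAtom R a 0) .bot) (varAtom R a 0)) (varAtom R a 0))

/-- `∀ x, R(x, a) ∨ (R(x, a) ⊃ ⊥)`. -/
def allEm : Fml L V 0 := .all (.or (varAtom R a 0) (.imp (varAtom R a 0) .bot))

/-- `∃ x, R(x, a) ⊃ ∀ y, R(y, a)`. -/
def drinker : Fml L V 0 := .ex (.imp (varAtom R a 0) (allAtom R a))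

/-- `∃ z, ∀ x, R(x, z)`. -/
def exAll : Fml L V 0 := .ex (.all (binAtom R (.var (Sum.inr 1)) (.var (Sum.inr 0))))

theorem counterConst_self : counterConst b b = 1 := by simp [counterConst]

variable {a b} in
theorem counterConst_of_ne (h : a ≠ b) : counterConst b a = 0 := by simp [counterConst, h]

theorem val_varAtom (κ : L.Constants → ℝ) {n : ℕ} (i : Fin n) (xs : Fin n → ℝ) :
    (counterModel L V).val κ (varAtom R a i) xs = counterRel (xs i) (κ a) := rfl

theorem val_allAtom (κ : L.Constants → ℝ) {n : ℕ} (xs : Fin n → ℝ) :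
    (counterModel L V).val κ (allAtom R a) xs = ⊥ := by
  simp only [allAtom, Interp.val, val_varAtom, Fin.snoc_last, iInf_counterRel]

variable {a b} in
theorem value_allOr (h : a ≠ b) :
    (counterModel L V).value (counterConst b) (allOr R a b) = ⊤ := by
  simp [allOr, Interp.val, val_varAtom, counterConst_self, counterConst_of_ne h, counterRel_sup]

variable {a b} in
theorem value_allPeirce (h : a ≠ b) :
    (counterModel L V).value (counterConst b) (allPeirce R a) = ⊥ := by
  simp only [allPeirce, Interp.value_all, Interp.val, val_varAtom, counterConst_of_ne h,
    counterRel_himp_bot, bot_himp, top_himp]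
  exact iInf_counterRel 0

variable {a b} in
theorem value_allEm (h : a ≠ b) :
    (counterModel L V).value (counterConst b) (allEm R a) = ⊥ := by
  simp only [allEm, Interp.value_all, Interp.val, val_varAtom, counterConst_of_ne h,
    counterRel_himp_bot, sup_bot_eq]
  exact iInf_counterRel 0

variable {a b} in
theorem value_drinker (h : a ≠ b) :
    (counterModel L V).value (counterConst b) (drinker R a) = ⊥ := by
  simp only [drinker, Interp.value_ex, Interp.val, val_varAtom, counterConst_of_ne h,
    val_allAtom, counterRel_himp_bot, iSup_bot]

theorem value_exAll : (counterModel L V).value (counterConst b) (exAll R) = ⊥ := by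
  rw [exAll, Interp.value_ex, iSup_eq_bot]
  intro z
  exact iInf_counterRel z

end Countermodel

/-! ### **C**-proofs with a prescribed set of restricted rules -/

section Classical

variable {L : FirstOrder.Language} {V : Type*}

/-- `Γ ⟶ Δ` has a **C**-proof in which exactly the rules in `S` are used among the restricted
ones. -/
def CProvableUsing (S : Set Rule) (Γ Δ : Multiset (Fml L V 0)) : Prop :=
  ∃ π : CProof Γ Δ, π.rules ∩ restrictedRules = S

namespace CProvableUsing

variable {S T : Set Rule} {Γ Δ Θ : Multiset (Fml L V 0)} {A B C : Fml L V 0} {E : Fml L V 1}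

theorem ax (h : IsAxiomSequent Γ Δ) : CProvableUsing ∅ Γ Δ := ⟨.ax h, Set.empty_inter _⟩

theorem singleton_union_inter {r : Rule} (hr : r ∈ restrictedRules) (X : Set Rule) :
    ({r} ∪ X) ∩ restrictedRules = insert r (X ∩ restrictedRules) := by
  rw [Set.singleton_union, Set.insert_inter_of_mem hr]

theorem singleton_union_inter_of_notMem {r : Rule} (hr : r ∉ restrictedRules) (X : Set Rule) :
    ({r} ∪ X) ∩ restrictedRules = X ∩ restrictedRules := by
  rw [Set.singleton_union, Set.insert_inter_of_notMem hr]

theorem contrR (d : CProvableUsing S Γ (B ::ₘ B ::ₘ Δ)) : CProvableUsing S Γ (B ::ₘ Δ) := by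
  obtain ⟨π, rfl⟩ := d
  exact ⟨.contrR π, singleton_union_inter_of_notMem (by simp [restrictedRules]) _⟩

theorem botR (d : CProvableUsing S Γ (.bot ::ₘ Δ)) : CProvableUsing S Γ (B ::ₘ Δ) := by
  obtain ⟨π, rfl⟩ := d
  exact ⟨.botR π, singleton_union_inter_of_notMem (by simp [restrictedRules]) _⟩

theorem andR (d : CProvableUsing S Γ (B ::ₘ Δ)) (e : CProvableUsing T Γ (C ::ₘ Δ)) :
    CProvableUsing (S ∪ T) Γ (.and B C ::ₘ Δ) := by
  obtain ⟨π, rfl⟩ := d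
  obtain ⟨π', rfl⟩ := e
  refine ⟨.andR π π', ?_⟩
  rw [CProof.rules, singleton_union_inter_of_notMem (by simp [restrictedRules]),
    Set.union_inter_distrib_right]

theorem orL (d : CProvableUsing S (B ::ₘ Γ) Δ) (e : CProvableUsing T (C ::ₘ Γ) Δ) :
    CProvableUsing (insert .orL (S ∪ T)) (.or B C ::ₘ Γ) Δ := by
  obtain ⟨π, rfl⟩ := d
  obtain ⟨π', rfl⟩ := e
  refine ⟨.orL π π', ?_⟩
  rw [CProof.rules, singleton_union_inter (by simp [restrictedRules]),
    Set.union_inter_distrib_right]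

theorem orR₁ (d : CProvableUsing S Γ (B ::ₘ Δ)) :
    CProvableUsing (insert .orR S) Γ (.or B C ::ₘ Δ) := by
  obtain ⟨π, rfl⟩ := d
  exact ⟨.orR₁ π, singleton_union_inter (by simp [restrictedRules]) _⟩

theorem orR₂ (d : CProvableUsing S Γ (C ::ₘ Δ)) :
    CProvableUsing (insert .orR S) Γ (.or B C ::ₘ Δ) := by
  obtain ⟨π, rfl⟩ := d
  exact ⟨.orR₂ π, singleton_union_inter (by simp [restrictedRules]) _⟩

theorem impL (d : CProvableUsing S Γ (B ::ₘ Δ)) (e : CProvableUsing T (C ::ₘ Γ) Θ) :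
    CProvableUsing (insert .impL (S ∪ T)) (.imp B C ::ₘ Γ) (Δ + Θ) := by
  obtain ⟨π, rfl⟩ := d
  obtain ⟨π', rfl⟩ := e
  refine ⟨.impL π π', ?_⟩
  rw [CProof.rules, singleton_union_inter (by simp [restrictedRules]),
    Set.union_inter_distrib_right]

/-- `⊃`-L adds up the succedents of its premises, so a shared side formula `A` is contracted
afterwards. -/
theorem impL_contr (d : CProvableUsing S Γ (B ::ₘ A ::ₘ 0))
    (e : CProvableUsing T (C ::ₘ Γ) (A ::ₘ 0)) :
    CProvableUsing (insert .impL (S ∪ T)) (.imp B C ::ₘ Γ) (A ::ₘ 0) := by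
  have h := d.impL e
  rw [Multiset.cons_add, zero_add] at h
  exact h.contrR

theorem impR (d : CProvableUsing S (B ::ₘ Γ) (C ::ₘ Δ)) :
    CProvableUsing (insert .impR S) Γ (.imp B C ::ₘ Δ) := by
  obtain ⟨π, rfl⟩ := d
  exact ⟨.impR π, singleton_union_inter (by simp [restrictedRules]) _⟩

/-- The instance is a separate argument `A`, so that premises can be stated with substitution
already carried out. -/
theorem allL (t : L.Term V) (d : CProvableUsing S (A ::ₘ Γ) Δ) (hA : E.inst t = A := by simp) :
    CProvableUsing (insert .allL S) (.all E ::ₘ Γ) Δ := by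
  subst hA
  obtain ⟨π, rfl⟩ := d
  exact ⟨.allL t π, singleton_union_inter (by simp [restrictedRules]) _⟩

theorem exR (t : L.Term V) (d : CProvableUsing S Γ (A ::ₘ Δ)) (hA : E.inst t = A := by simp) :
    CProvableUsing (insert .exR S) Γ (.ex E ::ₘ Δ) := by
  subst hA
  obtain ⟨π, rfl⟩ := d
  exact ⟨.exR t π, singleton_union_inter (by simp [restrictedRules]) _⟩

theorem allR (c : L.Constants) (d : CProvableUsing S Γ (A ::ₘ Δ))
    (hc : FreshFor c Γ (.all E ::ₘ Δ)) (hA : E.inst c.term = A := by simp) :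
    CProvableUsing (insert .allR S) Γ (.all E ::ₘ Δ) := by
  subst hA
  obtain ⟨π, rfl⟩ := d
  exact ⟨.allR c hc π, singleton_union_inter (by simp [restrictedRules]) _⟩

theorem congr_rules (d : CProvableUsing S Γ Δ) (h : ∀ r, r ∈ S ↔ r ∈ T) :
    CProvableUsing T Γ Δ :=
  Set.ext h ▸ d

theorem swapR (d : CProvableUsing S Γ (A ::ₘ B ::ₘ Δ)) : CProvableUsing S Γ (B ::ₘ A ::ₘ Δ) :=
  Multiset.cons_swap A B Δ ▸ d

end CProvableUsing

/-- Valid formulas whose connectives allow a use of each of the rules on the left. -/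
def spares (L : FirstOrder.Language) (V : Type*) : Multiset (Fml L V 0) :=
  {.or .top .top, .imp .top .top, .all .top}

theorem not_constIn_spares (c : L.Constants) : ∀ A ∈ spares L V, ¬ ConstIn c A := by
  simp [spares, ConstIn]

theorem spares_valid {H D : Type*} [Order.Frame H] (M : Interp L V H D) (κ : L.Constants → D) :
    ∀ A ∈ spares L V, M.value κ A = ⊤ := by
  simp [spares, Interp.val]

/-- Each restricted rule can be used alone to prove some valid formula. -/
theorem exists_valid_cProvableUsing [Infinite L.Constants] {Γ : Multiset (Fml L V 0)}
    (hΓ : spares L V ⊆ Γ) {r : Rule} (hr : r ∈ restrictedRules) {H D : Type*} [Order.Frame H]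
    (M : Interp L V H D) (κ : L.Constants → D) :
    ∃ G : Fml L V 0, M.value κ G = ⊤ ∧ CProvableUsing {r} Γ (G ::ₘ 0) := by
  have hax : ∀ Γ Δ : Multiset (Fml L V 0), CProvableUsing ∅ Γ (.top ::ₘ Δ) := fun Γ Δ =>
    .ax (Or.inl (Multiset.mem_cons_self _ _))
  have hS : insert r (∅ ∪ ∅ : Set Rule) = {r} := by simp
  have hS' : insert r (∅ : Set Rule) = {r} := by simp
  let c : L.Constants := Classical.arbitrary _
  -- Over an empty domain `∃ x, ⊤` would have value `⊥`.
  have : Nonempty D := ⟨κ c⟩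
  rcases hr with rfl | rfl | rfl | rfl | rfl | rfl | rfl
  · obtain ⟨c, hc⟩ := exists_freshFor Γ (.all .top ::ₘ 0)
    exact ⟨.all .top, by simp [Interp.val], hS' ▸ .allR c (hax _ _) hc rfl⟩
  · exact ⟨.imp .top .top, by simp [Interp.val], hS' ▸ .impR (hax _ _)⟩
  · obtain ⟨Γ, rfl⟩ := Multiset.exists_cons_of_mem (hΓ (by simp [spares] : .or .top .top ∈ _))
    exact ⟨.top, rfl, hS ▸ .orL (hax _ _) (hax _ _)⟩
  · obtain ⟨Γ, rfl⟩ := Multiset.exists_cons_of_mem (hΓ (by simp [spares] : .all .top ∈ _))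
    exact ⟨.top, rfl, hS' ▸ .allL c.term (hax _ _) rfl⟩
  · obtain ⟨Γ, rfl⟩ := Multiset.exists_cons_of_mem (hΓ (by simp [spares] : .imp .top .top ∈ _))
    exact ⟨.top, rfl, hS ▸ zero_add (Fml.top ::ₘ 0) ▸ .impL (hax _ _) (hax _ _)⟩
  · exact ⟨.or .top .top, by simp [Interp.val], hS' ▸ .orR₁ (hax _ _)⟩
  · exact ⟨.ex .top, by simp [Interp.val], hS' ▸ .exR c.term (hax _ _) rfl⟩

end Classical

section Classical

variable {L : FirstOrder.Language} {V : Type*} (R : L.Relations 2)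

/-- Each missing rule is brought in by conjoining a valid formula whose proof uses only that rule.
`∧`-R is not among the restricted rules, and the conjunct leaves the value unchanged. -/
theorem exists_extend_cProvableUsing [Infinite L.Constants] {Γ : Multiset (Fml L V 0)}
    (hΓ : spares L V ⊆ Γ) {S T : Set Rule} (hS : S ⊆ restrictedRules) {H D : Type*}
    [Order.Frame H] (M : Interp L V H D) (κ : L.Constants → D) {F : Fml L V 0}
    (hF : CProvableUsing T Γ (F ::ₘ 0)) :
    ∃ F' : Fml L V 0, M.value κ F' = M.value κ F ∧ CProvableUsing (T ∪ S) Γ (F' ::ₘ 0) := by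
  have hfin : S.Finite := Set.Finite.subset (by simp [restrictedRules]) hS
  induction S, hfin using Set.Finite.induction_on with
  | empty => exact ⟨F, rfl, by simpa using hF⟩
  | @insert r S _ _ ih =>
    obtain ⟨F', hv, hF'⟩ := ih ((Set.subset_insert _ _).trans hS)
    obtain ⟨G, hG, hp⟩ := exists_valid_cProvableUsing hΓ (hS (Set.mem_insert _ _)) M κ
    refine ⟨.and F' G, ?_, ?_⟩
    · rw [Interp.value_and, hG, inf_top_eq, hv]
    · have := hF'.andR hp
      rwa [Set.union_assoc, Set.union_singleton] at this

/-- Atoms with constants. -/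
def constAtom (c a : L.Constants) : Fml L V 0 := binAtom R c.term a.term

@[simp] theorem inst_varAtom_zero (c a : L.Constants) :
    (varAtom R a (0 : Fin 1) : Fml L V 1).inst c.term = constAtom R c a := by
  simp [varAtom, constAtom]

@[simp] theorem inst_varAtom_zero_two (c a : L.Constants) :
    (varAtom R a (0 : Fin 2) : Fml L V 2).inst c.term = binAtom R c.term a.term := by
  simp [varAtom]

@[simp] theorem inst_varAtom_one (c a : L.Constants) :
    (varAtom R a (1 : Fin 2) : Fml L V 2).inst c.term = varAtom R a 0 := by
  simp [varAtom]

@[simp] theorem inst_allAtom (c a : L.Constants) :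
    (allAtom R a : Fml L V 1).inst c.term = allAtom R a :=
  congrArg Fml.all (inst_varAtom_one R c a)

@[simp] theorem constIn_varAtom {a c : L.Constants} {n : ℕ} (i : Fin n) :
    ConstIn c (varAtom R a i : Fml L V n) ↔ a = c := by
  simp [varAtom]

@[simp] theorem constIn_constAtom {a c d : L.Constants} :
    ConstIn c (constAtom R d a : Fml L V 0) ↔ d = c ∨ a = c := by
  simp [constAtom]

theorem IsAxiomSequent.constAtom {R : L.Relations 2} {c a : L.Constants}
    {Γ Δ : Multiset (Fml L V 0)} (h : constAtom R c a ∈ Γ) (h' : constAtom R c a ∈ Δ) :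
    IsAxiomSequent Γ Δ := Or.inr ⟨binAtom R c.term a.term, trivial, h, h'⟩

variable {R}

theorem inst_exAll_body (c : L.Constants) :
    (Fml.all (binAtom R (.var (Sum.inr 1)) (.var (Sum.inr 0))) : Fml L V 1).inst c.term =
      allAtom R c := by
  simp [allAtom, varAtom]

variable {a b : L.Constants} {Γ : Multiset (Fml L V 0)} [Infinite L.Constants]

theorem cProvableUsing_allPeirce (hΓ : ∀ c, ∀ A ∈ Γ, ¬ ConstIn c A) :
    CProvableUsing {.allR, .impR, .impL} Γ (allPeirce R a ::ₘ 0) := by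
  obtain ⟨c, hc⟩ := (Set.finite_singleton a).exists_notMem
  have hca : ¬ a = c := fun h => hc h.symm
  have h1 : CProvableUsing _ (constAtom R c a ::ₘ Γ) (.bot ::ₘ constAtom R c a ::ₘ 0) :=
    .ax (.constAtom (R := R) (c := c) (a := a) (by simp) (by simp))
  have h2 : CProvableUsing _ (constAtom R c a ::ₘ Γ) (constAtom R c a ::ₘ 0) :=
    .ax (.constAtom (R := R) (c := c) (a := a) (by simp) (by simp))
  have h3 := (h1.impR.impL_contr h2).impR
  have h4 := CProvableUsing.allR (E := .imp (.imp (.imp (varAtom R a 0) .bot) (varAtom R a 0))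
    (varAtom R a 0)) c h3 ⟨hΓ c, by simp [ConstIn, hca]⟩
  exact CProvableUsing.congr_rules h4 fun r => by
    simp
    tauto

theorem cProvableUsing_allEm (hΓ : ∀ c, ∀ A ∈ Γ, ¬ ConstIn c A) :
    CProvableUsing {.allR, .impR, .orR} Γ (allEm R a ::ₘ 0) := by
  obtain ⟨c, hc⟩ := (Set.finite_singleton a).exists_notMem
  have hca : ¬ a = c := fun h => hc h.symm
  have h1 : CProvableUsing _ (constAtom R c a ::ₘ Γ) (constAtom R c a ::ₘ .bot ::ₘ 0) :=
    .ax (.constAtom (R := R) (c := c) (a := a) (by simp) (by simp))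
  have h2 := (h1.orR₁ (C := .imp (constAtom R c a) .bot)).swapR.impR.orR₂
    (B := constAtom R c a) |>.contrR
  have h4 := CProvableUsing.allR (E := .or (varAtom R a 0) (.imp (varAtom R a 0) .bot)) c
    h2 ⟨hΓ c, by simp [ConstIn, hca]⟩
  exact CProvableUsing.congr_rules h4 fun r => by
    simp

/-- Read from below, the first witness `a` is arbitrary. The eigenconstant `c` of the resulting
universal goal is then the second witness, and contr-R merges the two. -/
theorem cProvableUsing_drinker (hΓ : ∀ c, ∀ A ∈ Γ, ¬ ConstIn c A) :
    CProvableUsing {.allR, .impR, .exR} Γ (drinker R a ::ₘ 0) := by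
  obtain ⟨c, hc⟩ := (Set.finite_singleton a).exists_notMem
  have hca : ¬ a = c := fun h => hc h.symm
  have h1 : CProvableUsing _ (constAtom R c a ::ₘ constAtom R a a ::ₘ Γ)
      (allAtom R a ::ₘ constAtom R c a ::ₘ 0) :=
    .ax (.constAtom (R := R) (c := c) (a := a) (by simp) (by simp))
  have h2 := CProvableUsing.exR (E := .imp (varAtom R a 0) (allAtom R a)) c.term h1.impR
  have h3 := CProvableUsing.allR (E := varAtom R a 0) c h2.swapR
    ⟨by simpa [hca] using hΓ c, by simp [ConstIn, hca, allAtom]⟩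
  have h4 := CProvableUsing.exR (E := .imp (varAtom R a 0) (allAtom R a)) a.term h3.impR
    (by simp; rfl)
  exact CProvableUsing.congr_rules h4.contrR fun r => by
    simp
    tauto

/-- The common core of the three sequents without `⊃`-R: for distinct fresh `c` and `d`, the
instance `R(c, a) ∨ R(d, b)` settles one of the two goals. The two succedent formulas are then
joined by one of `⊃`-L, `∨`-R, `∃`-R. -/
theorem cProvableUsing_allAtom_allAtom (hΓ : ∀ c, ∀ A ∈ Γ, ¬ ConstIn c A) :
    CProvableUsing {.allR, .orL, .allL} (allOr R a b ::ₘ Γ)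
      (allAtom R a ::ₘ allAtom R b ::ₘ 0) := by
  obtain ⟨c, hc⟩ := (Set.toFinite {a, b}).exists_notMem
  obtain ⟨d, hd⟩ := (Set.toFinite {a, b, c}).exists_notMem
  simp only [Set.mem_insert_iff, Set.mem_singleton_iff, not_or] at hc hd
  have hca : ¬ a = c := fun h => hc.1 h.symm
  have hcb : ¬ b = c := fun h => hc.2 h.symm
  have hda : ¬ a = d := fun h => hd.1 h.symm
  have hdb : ¬ b = d := fun h => hd.2.1 h.symm
  have hdc : ¬ c = d := fun h => hd.2.2 h.symm
  have h1 : CProvableUsing _ (constAtom R c a ::ₘ Γ) (constAtom R d b ::ₘ constAtom R c a ::ₘ 0) :=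
    .ax (.constAtom (R := R) (c := c) (a := a) (by simp) (by simp))
  have h2 : CProvableUsing _ (constAtom R d b ::ₘ Γ) (constAtom R d b ::ₘ constAtom R c a ::ₘ 0) :=
    .ax (.constAtom (R := R) (c := d) (a := b) (by simp) (by simp))
  have h3 := CProvableUsing.allL (E := .or (binAtom R c.term a.term) (varAtom R b 0)) d.term
    (h1.orL h2) (by simp; rfl)
  have h4 := CProvableUsing.allL (E := .all (.or (varAtom R a 0) (varAtom R b 1))) c.term h3
  have h5 := CProvableUsing.allR (E := varAtom R b 0) d h4
    ⟨by simpa [hda, hdb, ConstIn] using hΓ d, by simp [ConstIn, hda, hdb, hdc]⟩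
  have h6 := CProvableUsing.allR (E := varAtom R a 0) c h5.swapR
    ⟨by simpa [hca, hcb, ConstIn] using hΓ c, by simp [ConstIn, hca, hcb]⟩
  exact CProvableUsing.congr_rules h6 fun r => by
    simp
    tauto

theorem cProvableUsing_allAtom (hΓ : ∀ c, ∀ A ∈ Γ, ¬ ConstIn c A) :
    CProvableUsing {.allR, .orL, .allL, .impL} (.imp (allAtom R a) .bot ::ₘ allOr R a b ::ₘ Γ)
      (allAtom R b ::ₘ 0) := by
  have h1 := cProvableUsing_allAtom_allAtom (R := R) (a := a) (b := b) hΓ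
  have h2 : CProvableUsing _ (.bot ::ₘ allOr R a b ::ₘ Γ) (.bot ::ₘ (0 : Multiset (Fml L V 0))) :=
    .ax (Or.inr ⟨.bot, trivial, by simp, by simp⟩)
  exact CProvableUsing.congr_rules (h1.impL_contr (h2.botR (B := allAtom R b))) fun r => by
    simp
    tauto

theorem cProvableUsing_or (hΓ : ∀ c, ∀ A ∈ Γ, ¬ ConstIn c A) :
    CProvableUsing {.allR, .orL, .allL, .orR} (allOr R a b ::ₘ Γ)
      (.or (allAtom R a) (allAtom R b) ::ₘ 0) := by
  have h1 := cProvableUsing_allAtom_allAtom (R := R) (a := a) (b := b) hΓ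
  exact CProvableUsing.congr_rules h1.orR₁.swapR.orR₂.contrR fun r => by
    simp
    tauto

theorem cProvableUsing_exAll (hΓ : ∀ c, ∀ A ∈ Γ, ¬ ConstIn c A) :
    CProvableUsing {.allR, .orL, .allL, .exR} (allOr R a b ::ₘ Γ) (exAll R ::ₘ 0) := by
  have h1 := cProvableUsing_allAtom_allAtom (R := R) (a := a) (b := b) hΓ
  have h2 := (h1.exR a.term (inst_exAll_body a)).swapR
  exact CProvableUsing.congr_rules ((h2.exR b.term (inst_exAll_body b)).contrR) fun r => by
    simp
    tauto

/-- For every set of rules that violates the four conditions there is a classically provable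
sequent with a true antecedent and a false succedent in the countermodel. -/
theorem exists_base (R : L.Relations 2) (hab : a ≠ b) {S : Set Rule}
    (hS : ¬ MeetsSomeCondition S) :
    ∃ (Γ : Multiset (Fml L V 0)) (F : Fml L V 0) (T : Set Rule), T ⊆ S ∧ spares L V ⊆ Γ ∧
      (∀ A ∈ Γ, (counterModel L V).value (counterConst b) A = ⊤) ∧
      (counterModel L V).value (counterConst b) F = ⊥ ∧ CProvableUsing T Γ (F ::ₘ 0) := by
  have hs := not_constIn_spares (L := L) (V := V)
  have hv := spares_valid (counterModel L V) (counterConst b)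
  have hOr : ∀ A ∈ allOr R a b ::ₘ spares L V,
      (counterModel L V).value (counterConst b) A = ⊤ := by
    simpa only [Multiset.forall_mem_cons] using ⟨value_allOr R hab, hv⟩
  have hsub : spares L V ⊆ allOr R a b ::ₘ spares L V := Multiset.subset_cons _ _
  have hbot : ∀ c : L.Constants,
      (counterModel L V).value (counterConst b) (allAtom R c) = ⊥ := fun c =>
    val_allAtom R c _ _
  simp only [MeetsSomeCondition, not_or, not_and_or, not_not] at hS
  obtain ⟨hall, h2, h3, h4⟩ := hS
  rw [or_iff_not_imp_left] at h2 h3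
  -- A use of `⊃`-R violates conditions 2 and 3 together; without it both `∨`-L and `∀`-L are
  -- forced. Either way, one of three rules violates condition 4, which yields six sequents.
  by_cases himp : Rule.impR ∈ S
  · rcases h4 with h4 | h4 | h4
    · exact ⟨_, _, _, by simp [Set.insert_subset_iff, *], Multiset.Subset.refl _, hv, value_allPeirce R hab,
        cProvableUsing_allPeirce hs⟩
    · exact ⟨_, _, _, by simp [Set.insert_subset_iff, *], Multiset.Subset.refl _, hv, value_allEm R hab,
        cProvableUsing_allEm hs⟩
    · exact ⟨_, _, _, by simp [Set.insert_subset_iff, *], Multiset.Subset.refl _, hv, value_drinker R hab,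
        cProvableUsing_drinker hs⟩
  · have h2 := h2 himp
    have h3 := h3 himp
    rcases h4 with h4 | h4 | h4
    · refine ⟨_, _, _, by simp [Set.insert_subset_iff, *], Multiset.Subset.trans hsub (Multiset.subset_cons _ _),
        ?_, hbot b, cProvableUsing_allAtom hs⟩
      refine Multiset.forall_mem_cons.2 ⟨?_, hOr⟩
      rw [Interp.value_imp, hbot a, bot_himp]
    · refine ⟨_, _, _, by simp [Set.insert_subset_iff, *], hsub, hOr, ?_, cProvableUsing_or hs⟩
      rw [Interp.value_or, hbot a, hbot b, sup_bot_eq]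
    · exact ⟨_, _, _, by simp [Set.insert_subset_iff, *], hsub, hOr, value_exAll R b,
        cProvableUsing_exAll hs⟩

end Classical

/-! ### The theorem -/

theorem mainTheorem3 (L : FirstOrder.Language) (V : Type*) [Infinite L.Constants] :
    (∀ (Γ : Multiset (Fml L V 0)) (F : Fml L V 0) (π : CProof Γ {F}),
      MeetsSomeCondition π.rules → IProvable (Fml.imp F Fml.bot ::ₘ Γ) F) ∧
    (Nonempty (L.Relations 2) →
      ∀ S : Set Rule, S ⊆ restrictedRules → ¬ MeetsSomeCondition S →
        ∃ (Γ : Multiset (Fml L V 0)) (F : Fml L V 0) (π : CProof Γ {F}),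
          π.rules ∩ restrictedRules = S ∧
          ¬ IProvable (Fml.imp F Fml.bot ::ₘ Γ) F) := by
  refine ⟨fun Γ F π hπ => iProvable_of_meetsSomeCondition π hπ, ?_⟩
  rintro ⟨R⟩ S hS hS'
  obtain ⟨a, b, hab⟩ := exists_pair_ne L.Constants
  obtain ⟨Γ, F, T, hTS, hΓ, hv, hF, hp⟩ := exists_base (V := V) R hab hS'
  obtain ⟨F', hF', π, hπ⟩ :=
    exists_extend_cProvableUsing hΓ hS (counterModel L V) (counterConst b) hp
  rw [Set.union_eq_self_of_subset_left hTS] at hπ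
  rw [hF] at hF'
  refine ⟨Γ, F', π, hπ, ?_⟩
  rintro ⟨ρ, hρ⟩
  -- As `F'` has value `⊥`, the added hypothesis `F' ⊃ ⊥` has value `⊤`, so soundness would make
  -- `F'` true.
  have hle : (⊤ : Opens ℝ) ≤ (counterModel L V).value (counterConst b) F' := by
    refine (counterModel L V).le_value_of_isIProof ρ hρ ?_ F' (Multiset.mem_singleton_self _)
    refine Interp.below_cons.2 ⟨?_, fun A hA => (hv A hA).ge⟩
    rw [Interp.value_imp, hF', bot_himp]
  rw [hF'] at hle
  exact bot_ne_top (le_bot_iff.1 hle).symm
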